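/- Let $\mathcal C^m_2=\{x\in\mathbf R^{m+1} : x_1^2+\dots+x_m^2=x_{m+1}^2\}$ be the standard double cone with vertex $\mathbf 0$. A map defined on an open subset $U$ of $\mathcal C^m_2$ is real analytic if it is the restriction to $U=\mathcal C^m_2\cap\Omega$ of a real analytic map on an open set $\Omega\subset\mathbf R^{m+1}$. A real analytic DC-manifold of dimension $m$ is a locally compact, second countable Hausdorff space with an atlas of homeomorphisms from open subsets onto connected open subsets of $\mathcal C^m_2$ with real analytic transition maps. The points sent to $\mathbf 0$ by a compatible chart are its DC-points; an ordinary real analytic manifold is a DC-manifold without DC-points. Maps between DC-manifolds, or from a DC-manifold to a real analytic manifold, are DC-analytic if they are real analytic in charts. A DC-analytic map $f\colon X^m\to N^n$ ($n>m$) into a real analytic manifold is a real analytic DC-immersion if for each $p\in X^m$ there are a compatible chart $\phi$ on a neighbourhood $U$ of $p$ and a real analytic diffeomorphism $\Phi$ from a neighbourhood of $f(p)$ containing $f(U)$ onto an open subset of $\mathbf R^n$ such that $\Phi\circ f\circ\phi^{-1}(a)=(a,0,\dots,0)$. A DC-analytic map $f_2\colon X_2\to N$ is an analytic extension of a DC-analytic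 map $f_1\colon X_1\to N$ (with $\dim X_1=\dim X_2$) if $f_1=f_2\circ\varphi$ for some DC-analytic $\varphi\colon X_1\to X_2$ and $f_1(X_1)\subsetneq f_2(X_2)$. Let $S^3_1=\{-x_0^2+x_1^2+x_2^2+x_3^2=1\}$ be de Sitter 3-space in Lorentz–Minkowski space $\mathbf R^4_1$. A DC-immersion $f\colon X^2\to S^3_1$ of a connected DC-manifold is called a real analytic space-like CMC-1 DC-immersion if, outside the DC-points, it is a space-like immersion of constant mean curvature one on an open dense subset (light-like points being allowed elsewhere); mean curvature one refers to a suitable continuous unit normal field on that subset. A continuous map $f\colon X\to N$ into a real analytic manifold is $C^0$-arc-proper if for each continuous $\sigma\colon[0,1)\to X$ such that $f\circ\sigma$ extends continuously to $[0,1]$ there are $t_k\in[0,1)$ with $t_k\to1$ such that $\sigma(t_k)$ converges in $X$. A non-empty set $S\subset N$ is analytically complete if every real analytic $\Gamma\colon[0,1]\to N$ with $\Gamma([0,\varepsilon))\subset S$ for some $\varepsilon\in(0,1)$ satisfies $\Gamma([0,1])\subset S$. Put $y(v)=\cos 2v+v\sin 2v$ and let the G-catenoid of type LH be the map $f_{\mathrm{LH}}\colon\mathbf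 R^2\to S^3_1$, $$f_{\mathrm{LH}}(u,v)=\Bigl(v\cos 2v+\tfrac{u^2+v^2}{2}\sin 2v,\ u\sin 2v,\ y(v),\ v\cos 2v+\tfrac{u^2+v^2-2}{2}\sin 2v\Bigr).$$ Let $$\mathcal X_{\mathrm{LH}}=\{(\xi,x,v)\in\mathbf R^3 : -\xi\sin 2v+x^2+y(v)^2=1\},\qquad \tilde f_{\mathrm{LH}}(\xi,x,v)=\Bigl(\tfrac{\xi+\sin 2v}{2},\,x,\,y(v),\,\tfrac{\xi-\sin 2v}{2}\Bigr)\in S^3_1,$$ and let $\mathcal L_\pm=\{(t,0,\pm1,t) : t\in\mathbf R\}\subset S^3_1$. **Proposition.** The set $\mathcal X_{\mathrm{LH}}$ has the structure of a two-dimensional real analytic DC-manifold for which the inclusion into $\mathbf R^3$ is a real analytic DC-immersion, and such that the following hold. 1. The set of DC-points is countably infinite. 2. $\tilde f_{\mathrm{LH}}\colon\mathcal X_{\mathrm{LH}}\to S^3_1$ is a real analytic space-like CMC-1 DC-immersion; more precisely, on the complement of $\tilde f_{\mathrm{LH}}^{-1}(\mathcal L_+\cup\mathcal L_-)$, which contains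 no DC-points, it is a space-like immersion of constant mean curvature one. 3. $\tilde f_{\mathrm{LH}}$ is an analytic extension of $f_{\mathrm{LH}}$, and $\tilde f_{\mathrm{LH}}(\mathcal X_{\mathrm{LH}})=f_{\mathrm{LH}}(\mathbf R^2)\cup\mathcal L_+\cup\mathcal L_-$. 4. $\tilde f_{\mathrm{LH}}$ is not a proper map, but it is $C^0$-arc-proper. 5. The image $\tilde f_{\mathrm{LH}}(\mathcal X_{\mathrm{LH}})$ is analytically complete in $S^3_1$. -/

import Mathlib

open scoped Manifold ContDiff Topology

noncomputable section

/-! Double-cone manifolds -/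

/-- The `m`-dimensional standard double cone `x₁² + ⋯ + x_m² = x_{m+1}²` in `ℝ^{m+1}`. -/
def doubleCone (m : ℕ) : Set (EuclideanSpace ℝ (Fin (m + 1))) :=
  {x | ∑ j : Fin m, x (Fin.castSucc j) ^ 2 = x (Fin.last m) ^ 2}

/-- Real analyticity of a map on an open subset `U` of the double cone: `U` is the trace on the
cone of an open subset `Ω` of `ℝ^{m+1}`, and on `U` the map `g` is the restriction of a real
analytic map on `Ω`. -/
def ConeAnalyticOn {m : ℕ} {F : Type*} [NormedAddCommGroup F] [NormedSpace ℝ F]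
    (g : doubleCone m → F) (U : Set (doubleCone m)) : Prop :=
  ∃ Ω : Set (EuclideanSpace ℝ (Fin (m + 1))), IsOpen Ω ∧ Subtype.val ⁻¹' Ω = U ∧
    ∃ G : EuclideanSpace ℝ (Fin (m + 1)) → F, AnalyticOnNhd ℝ G Ω ∧ ∀ a ∈ U, G a = g a

/-- A real analytic double-cone structure (DC-structure) of dimension `m` on `X`. A chart is a
homeomorphism of an open subset of `X` onto a connected open subset of the double cone. -/
structure DCStructure (m : ℕ) (X : Type*) [TopologicalSpace X] where
  locallyCompact : LocallyCompactSpace X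
  hausdorff : T2Space X
  secondCountable : SecondCountableTopology X
  charts : Set (OpenPartialHomeomorph X (doubleCone m))
  cover : ∀ x : X, ∃ φ ∈ charts, x ∈ φ.source
  connected : ∀ φ ∈ charts, IsConnected φ.target
  compatible : ∀ φ ∈ charts, ∀ ψ ∈ charts,
    ConeAnalyticOn (fun a => (ψ (φ.symm a) : EuclideanSpace ℝ (Fin (m + 1))))
      (φ.symm.trans ψ).source

namespace DCStructure

variable {m : ℕ} {X : Type*} [TopologicalSpace X]

/-- Local DC-coordinate systems: the charts that are analytically compatible, in both
directions, with all charts of the DC-structure. -/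
def IsCoord (D : DCStructure m X) (ψ : OpenPartialHomeomorph X (doubleCone m)) : Prop :=
  ∀ φ ∈ D.charts,
    ConeAnalyticOn (fun a => (φ (ψ.symm a) : EuclideanSpace ℝ (Fin (m + 1))))
      (ψ.symm.trans φ).source ∧
    ConeAnalyticOn (fun a => (ψ (φ.symm a) : EuclideanSpace ℝ (Fin (m + 1))))
      (φ.symm.trans ψ).source

/-- `p` is a DC-point: some local DC-coordinate system maps it to the vertex of the cone. -/
def IsDCPoint (D : DCStructure m X) (p : X) : Prop :=
  ∃ ψ : OpenPartialHomeomorph X (doubleCone m), D.IsCoord ψ ∧ p ∈ ψ.source ∧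
    (ψ p : EuclideanSpace ℝ (Fin (m + 1))) = 0

/-- DC-analytic maps between DC-manifolds. -/
def IsAnalyticMap {k : ℕ} {Y : Type*} [TopologicalSpace Y] (D : DCStructure m X)
    (D' : DCStructure k Y) (f : X → Y) : Prop :=
  ∀ φ ∈ D.charts, ∀ ψ ∈ D'.charts,
    ConeAnalyticOn (fun a => (ψ (f (φ.symm a)) : EuclideanSpace ℝ (Fin (k + 1))))
      {a | a ∈ φ.target ∧ f (φ.symm a) ∈ ψ.source}

variable (n : ℕ) {N : Type*} [TopologicalSpace N] [ChartedSpace (EuclideanSpace ℝ (Fin n)) N]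

/-- DC-analytic maps from a DC-manifold to a real analytic manifold. -/
def IsAnalytic (D : DCStructure m X) (f : X → N) : Prop :=
  ∀ φ ∈ D.charts, ∀ ψ ∈ atlas (EuclideanSpace ℝ (Fin n)) N,
    ConeAnalyticOn (fun a => ψ (f (φ.symm a)))
      {a | a ∈ φ.target ∧ f (φ.symm a) ∈ ψ.source}

/-- `a ↦ (a, 0)`, from `ℝ^{m+1}` to `ℝ^n`, for `m < n`. -/
def zeroPad (m n : ℕ) (a : EuclideanSpace ℝ (Fin (m + 1))) : EuclideanSpace ℝ (Fin n) :=
  WithLp.toLp 2 fun i => if h : (i : ℕ) < m + 1 then a ⟨i, h⟩ else 0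

/-- `p` is a DC-regular point of `f`: for some local DC-coordinate system `φ` around `p` and some
real analytic diffeomorphism `Φ` of a neighbourhood of `f p` onto an open subset of `ℝ^n`,
`Φ ∘ f ∘ φ⁻¹` is `a ↦ (a, 0)`. -/
def IsRegularPoint (D : DCStructure m X) (f : X → N) (p : X) : Prop :=
  ∃ (φ : OpenPartialHomeomorph X (doubleCone m))
    (Φ : OpenPartialHomeomorph N (EuclideanSpace ℝ (Fin n))),
    D.IsCoord φ ∧ p ∈ φ.source ∧
    f p ∈ Φ.source ∧ ContMDiffOn (𝓡 n) (𝓡 n) ω Φ Φ.source ∧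
    ContMDiffOn (𝓡 n) (𝓡 n) ω Φ.symm Φ.target ∧
    ∀ q ∈ φ.source, f q ∈ Φ.source ∧ Φ (f q) = zeroPad m n (φ q)

/-- Real analytic DC-immersions into a real analytic manifold of dimension `n > m`. -/
def IsDCImmersion (D : DCStructure m X) (f : X → N) : Prop :=
  m < n ∧ D.IsAnalytic n f ∧ ∀ p, D.IsRegularPoint n f p

/-- `f₂` is an analytic extension of `f₁`. -/
def IsAnalyticExtension {X₁ X₂ : Type*} [TopologicalSpace X₁] [TopologicalSpace X₂]
    (D₁ : DCStructure m X₁) (D₂ : DCStructure m X₂) (f₁ : X₁ → N) (f₂ : X₂ → N) : Prop :=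
  D₁.IsAnalytic n f₁ ∧ D₂.IsAnalytic n f₂ ∧
    (∃ φ : X₁ → X₂, D₁.IsAnalyticMap D₂ φ ∧ f₁ = f₂ ∘ φ) ∧
    Set.range f₁ ⊂ Set.range f₂

end DCStructure

/-! Analytic completeness and arc-properness -/

section Completeness

variable (n : ℕ) {N : Type*} [TopologicalSpace N] [ChartedSpace (EuclideanSpace ℝ (Fin n)) N]

/-- A non-empty subset `S` of a real analytic manifold is analytically complete if a real analytic
arc on `[0,1]` which starts in `S` on some `[0, ε)` stays in `S`. -/
def AnalyticallyComplete (S : Set N) : Prop :=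
  S.Nonempty ∧ ∀ Γ : ℝ → N, ContMDiffOn 𝓘(ℝ, ℝ) (𝓡 n) ω Γ (Set.Icc 0 1) →
    (∃ ε : ℝ, 0 < ε ∧ ε < 1 ∧ ∀ t ∈ Set.Ico 0 ε, Γ t ∈ S) → ∀ t ∈ Set.Icc (0 : ℝ) 1, Γ t ∈ S

/-- `C^r`-arc-properness (`r` is a natural number, `∞` or `ω`) of a continuous map `f`: for every
continuous `σ` on `[0,1)` such that `f ∘ σ` extends to a `C^r` map on `[0,1]`, `σ` converges along
some sequence tending to `1`. -/
def IsArcProper {X : Type*} [TopologicalSpace X] (r : WithTop ℕ∞) (f : X → N) : Prop :=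
  Continuous f ∧ ∀ σ : Set.Ico (0 : ℝ) 1 → X, Continuous σ →
    (∃ Γ : ℝ → N, ContMDiffOn 𝓘(ℝ, ℝ) (𝓡 n) r Γ (Set.Icc 0 1) ∧
      ∀ t : Set.Ico (0 : ℝ) 1, Γ t = f (σ t)) →
    ∃ τ : ℕ → Set.Ico (0 : ℝ) 1,
      Filter.Tendsto (fun k => (τ k : ℝ)) Filter.atTop (𝓝 1) ∧
      ∃ x : X, Filter.Tendsto (fun k => σ (τ k)) Filter.atTop (𝓝 x)

end Completeness

/-! De Sitter 3-space -/

/-- The Lorentzian inner product of signature `(- + + +)` on `ℝ⁴`. -/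
def lorentz (x y : EuclideanSpace ℝ (Fin 4)) : ℝ :=
  -(x 0 * y 0) + x 1 * y 1 + x 2 * y 2 + x 3 * y 3

/-- De Sitter 3-space. -/
def deSitter : Set (EuclideanSpace ℝ (Fin 4)) := {x | lorentz x x = 1}

namespace deSitter

/-- `1 + y₀² - y₁² - y₂²`, the square of the missing coordinate in the charts below. -/
def quad (y : EuclideanSpace ℝ (Fin 3)) : ℝ := 1 + y 0 ^ 2 - y 1 ^ 2 - y 2 ^ 2

/-- Delete the `j`-th of the three space coordinates. -/
def drop (j : Fin 3) (x : EuclideanSpace ℝ (Fin 4)) : EuclideanSpace ℝ (Fin 3) :=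
  WithLp.toLp 2 fun k => x (j.succ.succAbove k)

/-- Insert the value `ε √(quad y)` as `j`-th space coordinate. -/
def fill (j : Fin 3) (ε : ℝ) (y : EuclideanSpace ℝ (Fin 3)) : EuclideanSpace ℝ (Fin 4) :=
  WithLp.toLp 2 (j.succ.insertNth (ε * √(quad y)) y)

theorem fill_mem (j : Fin 3) {ε : ℝ} (hε : ε ^ 2 = 1) {y : EuclideanSpace ℝ (Fin 3)}
    (hy : 0 < quad y) : fill j ε y ∈ deSitter := by
  have h : (ε * √(quad y)) ^ 2 = quad y := by rw [mul_pow, hε, Real.sq_sqrt hy.le, one_mul]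
  change lorentz _ _ = 1
  rw [lorentz]
  have h2 : quad y = 1 + y 0 ^ 2 - y 1 ^ 2 - y 2 ^ 2 := rfl
  generalize hs : ε * √(quad y) = s at h
  rw [h2] at h
  fin_cases j
  all_goals
    simp [fill, hs, Fin.insertNth, Fin.succAboveCases]
    try rw [show Fin.castPred (2 : Fin 4) (by decide) = (2 : Fin 3) from rfl]
    linarith

theorem quad_drop (j : Fin 3) {x : EuclideanSpace ℝ (Fin 4)} (hx : x ∈ deSitter) :
    quad (drop j x) = x j.succ ^ 2 := by
  change lorentz x x = 1 at hx
  rw [lorentz] at hx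
  fin_cases j
  all_goals
    simp [quad, drop, Fin.succAbove]
    linarith

theorem drop_fill (j : Fin 3) (ε : ℝ) (y : EuclideanSpace ℝ (Fin 3)) :
    drop j (fill j ε y) = y := by
  ext k
  simp [drop, fill]

theorem fill_drop (j : Fin 3) {ε : ℝ} (hε : ε ^ 2 = 1) {x : EuclideanSpace ℝ (Fin 4)}
    (hx : x ∈ deSitter) (h : 0 < ε * x j.succ) : fill j ε (drop j x) = x := by
  have h1 : √(quad (drop j x)) = ε * x j.succ := by
    rw [quad_drop j hx, ← Real.sqrt_sq h.le, mul_pow, hε, one_mul]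
  have h2 : ε * √(quad (drop j x)) = x j.succ := by
    rw [h1, ← mul_assoc, ← pow_two, hε, one_mul]
  ext k
  refine Fin.succAboveCases j.succ ?_ (fun i => ?_) k
  · simp [fill, h2]
  · simp [fill, drop]

theorem contDiff_quad : ContDiff ℝ ω quad := by
  unfold quad
  fun_prop

theorem contDiff_drop (j : Fin 3) : ContDiff ℝ ω (drop j) := by
  refine contDiff_euclidean.2 fun i => ?_
  simp only [drop]
  fun_prop

theorem contDiffOn_fill (j : Fin 3) (ε : ℝ) : ContDiffOn ℝ ω (fill j ε) {y | 0 < quad y} := by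
  refine contDiffOn_euclidean.2 fun i => ?_
  refine Fin.succAboveCases j.succ ?_ (fun i => ?_) i
  · simp only [fill, Fin.insertNth_apply_same]
    exact contDiffOn_const.mul (contDiff_quad.contDiffOn.sqrt fun y hy => ne_of_gt hy)
  · simp only [fill, Fin.insertNth_apply_succAbove]
    fun_prop

/-- The chart of de Sitter space on the open set where the `j`-th space coordinate has the
sign `ε = ±1`: delete this coordinate. -/
def chart (j : Fin 3) (ε : ℝ) (hε : ε ^ 2 = 1) :
    OpenPartialHomeomorph deSitter (EuclideanSpace ℝ (Fin 3)) where
  toFun x := drop j x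
  invFun y := if h : 0 < quad y then ⟨fill j ε y, fill_mem j hε h⟩
    else ⟨fill j ε 0, fill_mem j hε (by simp [quad])⟩
  source := {x | 0 < ε * (x : EuclideanSpace ℝ (Fin 4)) j.succ}
  target := {y | 0 < quad y}
  map_source' x hx := by
    change 0 < quad (drop j x)
    rw [quad_drop j x.2]
    exact sq_pos_of_ne_zero (right_ne_zero_of_mul (ne_of_gt hx))
  map_target' y hy := by
    have hy' : 0 < quad y := hy
    simp only [hy', dif_pos]
    change 0 < ε * (fill j ε y) j.succ
    simp only [fill, Fin.insertNth_apply_same, ← mul_assoc, ← pow_two, hε, one_mul]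
    exact Real.sqrt_pos.2 hy'
  left_inv' x hx := by
    have hx' : 0 < quad (drop j (x : EuclideanSpace ℝ (Fin 4))) := by
      rw [quad_drop j x.2]
      exact sq_pos_of_ne_zero (right_ne_zero_of_mul (ne_of_gt hx))
    simp only [hx', dif_pos]
    exact Subtype.ext (fill_drop j hε x.2 hx)
  right_inv' y hy := by
    have hy' : 0 < quad y := hy
    simp only [hy', dif_pos]
    exact drop_fill j ε y
  open_source := isOpen_lt continuous_const (by fun_prop)
  open_target := isOpen_lt continuous_const contDiff_quad.continuous
  continuousOn_toFun := ((contDiff_drop j).continuous.comp continuous_subtype_val).continuousOn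
  continuousOn_invFun := by
    refine Topology.IsInducing.subtypeVal.continuousOn_iff.2 ?_
    refine (contDiffOn_fill j ε).continuousOn.congr fun y hy => ?_
    have hy' : 0 < quad y := hy
    simp only [Function.comp, hy', dif_pos]

theorem exists_chart (x : deSitter) :
    ∃ j : Fin 3, ∃ ε : ℝ, ε ^ 2 = 1 ∧ 0 < ε * (x : EuclideanSpace ℝ (Fin 4)) j.succ := by
  by_contra! H
  have h0 : ∀ j : Fin 3, (x : EuclideanSpace ℝ (Fin 4)) j.succ = 0 := fun j => by
    have h1 := H j 1 (by norm_num)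
    have h2 := H j (-1) (by norm_num)
    linarith
  have h1 := h0 0
  have h2 := h0 1
  have h3 := h0 2
  have hx : lorentz x x = 1 := x.2
  simp only [lorentz, Fin.succ_zero_eq_one, Fin.succ_one_eq_two] at h1 h2 h3 hx
  rw [h1, h2, show (3 : Fin 4) = Fin.succ 2 from rfl, h3] at hx
  nlinarith [mul_self_nonneg ((x : EuclideanSpace ℝ (Fin 4)) 0)]

/-- De Sitter space with its charts as a hypersurface of `ℝ⁴`. -/
instance : ChartedSpace (EuclideanSpace ℝ (Fin 3)) deSitter where
  atlas := {e | ∃ (j : Fin 3) (ε : ℝ) (hε : ε ^ 2 = 1), e = chart j ε hε}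
  chartAt x := chart (exists_chart x).choose (exists_chart x).choose_spec.choose
    (exists_chart x).choose_spec.choose_spec.1
  mem_chart_source x := (exists_chart x).choose_spec.choose_spec.2
  chart_mem_atlas _ := ⟨_, _, _, rfl⟩

instance : IsManifold (𝓡 3) ω deSitter := by
  refine isManifold_of_contDiffOn _ _ _ ?_
  rintro _ _ ⟨i, ε, hε, rfl⟩ ⟨j, δ, hδ, rfl⟩
  have h : ContDiffOn ℝ ω (fun y => drop j (fill i ε y)) {y | 0 < quad y} :=
    (contDiff_drop j).comp_contDiffOn (contDiffOn_fill i ε)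
  refine (h.mono ?_).congr ?_
  · intro y hy
    exact hy.1.1
  · intro y hy
    have hy' : 0 < quad y := hy.1.1
    simp [chart, hy']

end deSitter

/-! Space-like surfaces of constant mean curvature one -/

/-- For a parametrized surface `g` in de Sitter space: at `w` its first fundamental form is
positive definite, and `ν` is a unit normal vector of the surface in de Sitter space with respect
to which the mean curvature `(E N - 2 F M + G L) / (2 (E G - F²))` equals `1`. -/
def IsSpacelikeCMCOneAt (g : ℝ × ℝ → EuclideanSpace ℝ (Fin 4)) (w : ℝ × ℝ)
    (ν : EuclideanSpace ℝ (Fin 4)) : Prop :=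
  let gu := fun z => fderiv ℝ g z (1, 0)
  let gv := fun z => fderiv ℝ g z (0, 1)
  let E := lorentz (gu w) (gu w)
  let F := lorentz (gu w) (gv w)
  let G := lorentz (gv w) (gv w)
  let L := lorentz (fderiv ℝ gu w (1, 0)) ν
  let M := lorentz (fderiv ℝ gu w (0, 1)) ν
  let N := lorentz (fderiv ℝ gv w (0, 1)) ν
  0 < E ∧ 0 < E * G - F ^ 2 ∧
    lorentz ν ν = -1 ∧ lorentz ν (g w) = 0 ∧ lorentz ν (gu w) = 0 ∧ lorentz ν (gv w) = 0 ∧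
    (E * N - 2 * F * M + G * L) / (2 * (E * G - F ^ 2)) = 1

namespace DCStructure

variable {X : Type*} [TopologicalSpace X]

/-- `q` is a regular real analytic local parametrization, near `w`, of a two-dimensional
DC-manifold near the point `q w`. -/
def IsLocalParam (D : DCStructure 2 X) (q : ℝ × ℝ → X) (w : ℝ × ℝ) : Prop :=
  ∃ φ : OpenPartialHomeomorph X (doubleCone 2), D.IsCoord φ ∧ q w ∈ φ.source ∧
    ContinuousAt q w ∧
    AnalyticAt ℝ (fun z => (φ (q z) : EuclideanSpace ℝ (Fin 3))) w ∧
    Function.Injective (fderiv ℝ (fun z => (φ (q z) : EuclideanSpace ℝ (Fin 3))) w)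

/-- `O` is an open set of non-DC-points on which `f` is a space-like immersion of constant mean
curvature one, with respect to a continuous unit normal vector field. -/
def IsSpacelikeCMCOneOn (D : DCStructure 2 X) (f : X → deSitter) (O : Set X) : Prop :=
  IsOpen O ∧ (∀ p ∈ O, ¬ D.IsDCPoint p) ∧
    ∃ ν : X → EuclideanSpace ℝ (Fin 4), ContinuousOn ν O ∧
      ∀ p ∈ O, ∃ (q : ℝ × ℝ → X) (w : ℝ × ℝ), D.IsLocalParam q w ∧ q w = p ∧
        IsSpacelikeCMCOneAt (fun z => (f (q z) : EuclideanSpace ℝ (Fin 4))) w (ν p)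

/-- Real analytic space-like CMC-1 DC-immersions of a connected DC-manifold into de Sitter space:
DC-immersions that, outside the DC-points, are space-like of constant mean curvature one on an
open dense subset (the induced metric may degenerate at the remaining points). -/
def IsSpacelikeCMCOneDCImmersion (D : DCStructure 2 X) (f : X → deSitter) : Prop :=
  ConnectedSpace X ∧ D.IsDCImmersion 3 f ∧
    ∃ O : Set X, Dense O ∧ D.IsSpacelikeCMCOneOn f O

end DCStructure

/-! The plane as a DC-manifold without DC-points -/

/-- A real analytic embedding of the plane onto the part `x₃ - x₁ > 0` of the double cone. -/
def planeToCone (w : ℝ × ℝ) : EuclideanSpace ℝ (Fin 3) :=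
  !₂[(w.2 ^ 2 * Real.exp (-w.1) - Real.exp w.1) / 2, w.2,
    (w.2 ^ 2 * Real.exp (-w.1) + Real.exp w.1) / 2]

theorem planeToCone_mem (w : ℝ × ℝ) : planeToCone w ∈ doubleCone 2 := by
  change ∑ j : Fin 2, planeToCone w (Fin.castSucc j) ^ 2 = planeToCone w (Fin.last 2) ^ 2
  have h : Real.exp (-w.1) * Real.exp w.1 = 1 := by rw [← Real.exp_add]; simp
  simp [Fin.sum_univ_two, planeToCone]
  linear_combination (-w.2 ^ 2) * h

theorem continuous_planeToCone : Continuous planeToCone := by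
  unfold planeToCone
  fun_prop

theorem sub_planeToCone (w : ℝ × ℝ) : planeToCone w 2 - planeToCone w 0 = Real.exp w.1 := by
  simp [planeToCone]
  ring

/-- The global chart of the plane given by `planeToCone`. -/
def planeChart : OpenPartialHomeomorph (ℝ × ℝ) (doubleCone 2) where
  toFun w := ⟨planeToCone w, planeToCone_mem w⟩
  invFun a := (Real.log ((a : EuclideanSpace ℝ (Fin 3)) 2 - (a : EuclideanSpace ℝ (Fin 3)) 0),
    (a : EuclideanSpace ℝ (Fin 3)) 1)
  source := Set.univ
  target := {a | 0 < (a : EuclideanSpace ℝ (Fin 3)) 2 - (a : EuclideanSpace ℝ (Fin 3)) 0}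
  map_source' w _ := by
    change 0 < planeToCone w 2 - planeToCone w 0
    rw [sub_planeToCone]
    exact Real.exp_pos _
  map_target' _ _ := Set.mem_univ _
  left_inv' w _ := by
    simp only [sub_planeToCone, Real.log_exp]
    simp [planeToCone]
  right_inv' a ha := by
    obtain ⟨a, h⟩ := a
    have ha' : 0 < a 2 - a 0 := ha
    have h' : ∑ j : Fin 2, a (Fin.castSucc j) ^ 2 = a (Fin.last 2) ^ 2 := h
    simp [Fin.sum_univ_two] at h'
    have h3 : a 1 ^ 2 * (a 2 - a 0)⁻¹ = a 2 + a 0 := by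
      field_simp
      linear_combination h'
    refine Subtype.ext ?_
    ext i
    fin_cases i
    · simp [planeToCone, Real.exp_neg, Real.exp_log ha', h3]
    · simp [planeToCone]
    · simp [planeToCone, Real.exp_neg, Real.exp_log ha', h3]
  open_source := isOpen_univ
  open_target := isOpen_lt continuous_const (by fun_prop)
  continuousOn_toFun := (continuous_planeToCone.subtype_mk _).continuousOn
  continuousOn_invFun := by
    refine ContinuousOn.prodMk (ContinuousOn.log (by fun_prop) fun a ha => ne_of_gt ha) (by fun_prop)

/-- The standard real analytic structure of the plane, as a DC-structure. -/
def planeDC : DCStructure 2 (ℝ × ℝ) where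
  locallyCompact := inferInstance
  hausdorff := inferInstance
  secondCountable := inferInstance
  charts := {planeChart}
  cover x := ⟨planeChart, rfl, Set.mem_univ x⟩
  connected φ hφ := by
    rw [Set.mem_singleton_iff.1 hφ, ← planeChart.image_source_eq_target]
    exact isConnected_univ.image _ planeChart.continuousOn_toFun
  compatible φ hφ ψ hψ := by
    rw [Set.mem_singleton_iff.1 hφ, Set.mem_singleton_iff.1 hψ]
    refine ⟨{a | 0 < a 2 - a 0}, isOpen_lt continuous_const (by fun_prop), ?_, id,
      fun _ _ => analyticAt_id, fun a ha => ?_⟩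
    · ext a
      simp [planeChart]
    · exact (congrArg Subtype.val (planeChart.right_inv ha.1)).symm

/-! The G-catenoid of type LH and its extension -/

namespace LH

/-- The matrices `P(u)`. -/
def P (u : ℝ) : Matrix (Fin 4) (Fin 4) ℝ :=
  !![1 + u ^ 2 / 2, u, 0, -(u ^ 2 / 2);
     u, 1, 0, -u;
     0, 0, 1, 0;
     u ^ 2 / 2, u, 0, 1 - u ^ 2 / 2]

/-- The function `y_LH`. -/
def y (v : ℝ) : ℝ := Real.cos (2 * v) + v * Real.sin (2 * v)

/-- The profile curve. -/
def profile (v : ℝ) : Fin 4 → ℝ :=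
  ![v * Real.cos (2 * v) + v ^ 2 / 2 * Real.sin (2 * v), 0, y v,
    v * Real.cos (2 * v) + (v ^ 2 - 2) / 2 * Real.sin (2 * v)]

/-- The G-catenoid of type LH, `(u, v) ↦ P(u) Γ(v)`. -/
def catenoid (w : ℝ × ℝ) : deSitter :=
  ⟨WithLp.toLp 2 (Matrix.mulVec (P w.1) (profile w.2)), by
    change lorentz _ _ = 1
    have h := Real.sin_sq_add_cos_sq (2 * w.2)
    simp [lorentz, P, profile, y, Matrix.mulVec, dotProduct, Fin.sum_univ_four]
    linear_combination h⟩

/-- The surface `-ξ sin 2v + x² + y_LH(v)² = 1` in the space of the `(ξ, x, v)`. -/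
def surface : Set (EuclideanSpace ℝ (Fin 3)) :=
  {p | -p 0 * Real.sin (2 * p 2) + p 1 ^ 2 + y (p 2) ^ 2 = 1}

/-- The map `(ξ, x, v) ↦ ((ξ + sin 2v)/2, x, y_LH(v), (ξ - sin 2v)/2)` on the surface. -/
def extension (p : surface) : deSitter :=
  ⟨!₂[((p : EuclideanSpace ℝ (Fin 3)) 0 + Real.sin (2 * (p : EuclideanSpace ℝ (Fin 3)) 2)) / 2,
      (p : EuclideanSpace ℝ (Fin 3)) 1,
      y ((p : EuclideanSpace ℝ (Fin 3)) 2),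
      ((p : EuclideanSpace ℝ (Fin 3)) 0 - Real.sin (2 * (p : EuclideanSpace ℝ (Fin 3)) 2)) / 2], by
    obtain ⟨p, hp⟩ := p
    have h : -p 0 * Real.sin (2 * p 2) + p 1 ^ 2 + y (p 2) ^ 2 = 1 := hp
    change lorentz _ _ = 1
    simp [lorentz]
    linear_combination h⟩

/-- The light-like lines `{(t, 0, s, t)}`, for `s = ±1`. -/
def line (s : ℝ) : Set deSitter :=
  {X | ∃ t : ℝ, (X : EuclideanSpace ℝ (Fin 4)) = !₂[t, 0, s, t]}

end LH

end

noncomputable section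

/-! Cone structure. Since `y² - 1 = height · sin 2v`, the surface equation reads `x² = sin 2v · (ξ -
height v)`. Near a zero `center k = kπ/2` of `sin 2v` one has `sin 2v = ratio k v · (v - center k)`
with an analytic, non-vanishing factor. Taking `v - center k` and `(ξ - height v) · ratio k v` as
the light-cone combinations `a₂ - a₀` and `a₂ + a₀` turns the equation into that of the double cone
(`toCone_mem_iff`). These charts cover the surface and come from diffeomorphisms of the ambient
space, so the inclusion is a DC-immersion. A change of coordinates cannot move the vertex
(`DCStructure.IsDCPoint.apply_eq_zero`), so there is exactly one DC-point for each integer `k`.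

Geometry. Where `sin 2v ≠ 0` the surface is the graph-like image of `param`, and the extension
composed with `param` is the catenoid. Its induced metric is `sin² 2v (du² + dv²)`, and an explicit
unit normal gives mean curvature one. Where `sin 2v = 0` the equation forces `x = 0` and `y² = 1`,
which yields the two light-like lines. The immersion property comes from extending the map off the
surface so that, in a chart of de Sitter space, it becomes a local diffeomorphism of 3-space
(`fderiv_ambientExtension_injective`).

Global behaviour. The image point determines `ξ`, `x` and `sin 2v`, so only `v` can escape. Some
fibre is unbounded in `v`, hence the map is not proper. But a continuous `v` for which `sin 2v`
converges must itself converge (`exists_tendsto_of_tendsto_sin_two_mul`), hence arc-properness.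
Finally, a point of de Sitter space lies in the image iff `(x₀ - x₃, x₂)` lies on the immersed plane
curve `v ↦ (sin 2v, y v)`, so analytic completeness reduces to continuing lifts of analytic arcs to
that curve (`mem_range_of_analytic_of_mem_range`). -/

theorem Real.contDiff_sinc : ContDiff ℝ ω Real.sinc := by
  refine contDiff_iff_contDiffAt.2 fun x => AnalyticAt.contDiffAt ?_
  rcases eq_or_ne x 0 with rfl | hx
  -- At `0` the quotient is the divided slope of `sin`, whose power series is the shifted series of
  -- `sin`.
  · rw [Real.sinc_eq_dslope]
    obtain ⟨p, hp⟩ := Real.analyticAt_sin (x := 0)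
    exact ⟨_, hp.has_fpower_series_dslope_fslope⟩
  · have h : AnalyticAt ℝ (fun t => Real.sin t / t) x :=
      Real.analyticAt_sin.div analyticAt_id hx
    refine h.congr ?_
    filter_upwards [isOpen_ne.mem_nhds hx] with t ht
    exact (Real.sinc_of_ne_zero ht).symm

theorem Real.sinc_mul_self (x : ℝ) : Real.sinc x * x = Real.sin x := by
  rcases eq_or_ne x 0 with rfl | hx
  · simp
  · rw [Real.sinc_of_ne_zero hx, div_mul_cancel₀ _ hx]

theorem Real.sinc_pos_of_abs_lt_pi {x : ℝ} (hx : |x| < Real.pi) : 0 < Real.sinc x := by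
  rcases lt_trichotomy x 0 with h | rfl | h
  · rw [Real.sinc_of_ne_zero h.ne]
    exact div_pos_of_neg_of_neg (Real.sin_neg_of_neg_of_neg_pi_lt h (abs_lt.1 hx).1) h
  · simp
  · rw [Real.sinc_of_ne_zero h.ne']
    exact div_pos (Real.sin_pos_of_pos_of_lt_pi h (abs_lt.1 hx).2) h

/-! ### Cone coordinates around the zeros of `sin 2v` -/

namespace LH

/-- The function `h` with `y² - 1 = h · sin 2v`. -/
def height (v : ℝ) : ℝ := 2 * v * Real.cos (2 * v) + (v ^ 2 - 1) * Real.sin (2 * v)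

@[fun_prop]
theorem contDiff_y : ContDiff ℝ ω y := by
  unfold y
  fun_prop

@[fun_prop]
theorem contDiff_height : ContDiff ℝ ω height := by
  unfold height
  fun_prop

theorem y_sq (v : ℝ) : y v ^ 2 = 1 + height v * Real.sin (2 * v) := by
  have h := Real.sin_sq_add_cos_sq (2 * v)
  simp only [y, height]
  linear_combination h

theorem mem_surface_iff {p : EuclideanSpace ℝ (Fin 3)} :
    p ∈ surface ↔ p 1 ^ 2 = Real.sin (2 * p 2) * (p 0 - height (p 2)) := by
  change -p 0 * Real.sin (2 * p 2) + p 1 ^ 2 + y (p 2) ^ 2 = 1 ↔ _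
  rw [y_sq]
  constructor <;> intro h <;> linear_combination h

theorem mem_doubleCone_two_iff {a : EuclideanSpace ℝ (Fin 3)} :
    a ∈ doubleCone 2 ↔ a 1 ^ 2 = (a 2 - a 0) * (a 2 + a 0) := by
  change ∑ j : Fin 2, a (Fin.castSucc j) ^ 2 = a (Fin.last 2) ^ 2 ↔ _
  have : ∑ j : Fin 2, a (Fin.castSucc j) ^ 2 = a (Fin.last 2) ^ 2 ↔
    a 0 ^ 2 + a 1 ^ 2 = a 2 ^ 2 := by simp [Fin.sum_univ_two]
  rw [this]
  constructor <;> intro h <;> linear_combination h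

/-- The zeros of `sin 2v`. -/
def center (k : ℤ) : ℝ := k * Real.pi / 2

/-- The analytic function `sin 2v / (v - center k)`. -/
def ratio (k : ℤ) (v : ℝ) : ℝ := (-1) ^ k * (2 * Real.sinc (2 * (v - center k)))

@[fun_prop]
theorem contDiff_ratio (k : ℤ) : ContDiff ℝ ω (ratio k) := by
  unfold ratio
  exact contDiff_const.mul (contDiff_const.mul (Real.contDiff_sinc.comp (by fun_prop)))

theorem ratio_mul (k : ℤ) (v : ℝ) : ratio k v * (v - center k) = Real.sin (2 * v) := by
  have h := Real.sinc_mul_self (2 * (v - center k))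
  have h2 : Real.sin (2 * (v - center k) + k * Real.pi) =
      (-1) ^ k * Real.sin (2 * (v - center k)) := Real.sin_add_int_mul_pi _ _
  rw [show 2 * (v - center k) + k * Real.pi = 2 * v by simp only [center]; ring] at h2
  rw [h2, ratio, ← h]
  ring

/-- The radius `π/2` is optimal: it is the distance to the next zero of `sin 2v`. -/
theorem ratio_ne_zero {k : ℤ} {v : ℝ} (h : |v - center k| < Real.pi / 2) : ratio k v ≠ 0 := by
  refine mul_ne_zero (zpow_ne_zero _ (by norm_num)) (mul_ne_zero two_ne_zero (ne_of_gt ?_))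
  refine Real.sinc_pos_of_abs_lt_pi ?_
  rw [abs_mul, abs_two]
  linarith

/-- The coordinates of the ambient space in which the surface is the double cone. -/
def toCone (k : ℤ) (p : EuclideanSpace ℝ (Fin 3)) : EuclideanSpace ℝ (Fin 3) :=
  !₂[((p 0 - height (p 2)) * ratio k (p 2) - (p 2 - center k)) / 2, p 1,
    ((p 0 - height (p 2)) * ratio k (p 2) + (p 2 - center k)) / 2]

/-- The inverse of `toCone`. -/
def ofCone (k : ℤ) (a : EuclideanSpace ℝ (Fin 3)) : EuclideanSpace ℝ (Fin 3) :=
  !₂[(a 2 + a 0) / ratio k (a 2 - a 0 + center k) + height (a 2 - a 0 + center k), a 1,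
    a 2 - a 0 + center k]

/-- The domain of `ofCone`. -/
def coneSlab : Set (EuclideanSpace ℝ (Fin 3)) := {a | |a 2 - a 0| < Real.pi / 2}

theorem isOpen_coneSlab : IsOpen coneSlab := isOpen_lt (by fun_prop) continuous_const

theorem contDiff_toCone (k : ℤ) : ContDiff ℝ ω (toCone k) := by
  refine contDiff_euclidean.2 fun i => ?_
  fin_cases i <;> simp [toCone] <;> fun_prop

theorem contDiffOn_ofCone (k : ℤ) : ContDiffOn ℝ ω (ofCone k) coneSlab := by
  refine contDiffOn_euclidean.2 fun i => ?_
  have h : ContDiffOn ℝ ω (fun a : EuclideanSpace ℝ (Fin 3) =>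
      (a 2 + a 0) / ratio k (a 2 - a 0 + center k)) coneSlab := by
    refine ContDiffOn.div (by fun_prop) (ContDiff.contDiffOn (by fun_prop)) fun a ha => ratio_ne_zero ?_
    rw [add_sub_cancel_right]
    exact ha
  fin_cases i
  · simp only [ofCone]
    exact h.add (ContDiff.contDiffOn (by fun_prop))
  · simp [ofCone]
    fun_prop
  · simp [ofCone]
    fun_prop

theorem toCone_sub (k : ℤ) (p : EuclideanSpace ℝ (Fin 3)) :
    toCone k p 2 - toCone k p 0 = p 2 - center k := by
  simp [toCone]
  ring

theorem toCone_add (k : ℤ) (p : EuclideanSpace ℝ (Fin 3)) :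
    toCone k p 2 + toCone k p 0 = (p 0 - height (p 2)) * ratio k (p 2) := by
  simp [toCone]
  ring

/-- `toCone k` as a local homeomorphism of the ambient space. -/
def ambientChart (k : ℤ) :
    OpenPartialHomeomorph (EuclideanSpace ℝ (Fin 3)) (EuclideanSpace ℝ (Fin 3)) where
  toFun := toCone k
  invFun := ofCone k
  source := {p | |p 2 - center k| < Real.pi / 2}
  target := coneSlab
  map_source' p hp := by
    change |toCone k p 2 - toCone k p 0| < _
    rwa [toCone_sub]
  map_target' a ha := by
    change |a 2 - a 0 + center k - center k| < _
    rwa [add_sub_cancel_right]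
  left_inv' p hp := by
    have h := ratio_ne_zero hp
    simp only [ofCone, toCone_sub, toCone_add, sub_add_cancel, mul_div_cancel_right₀ _ h]
    ext i
    fin_cases i <;> simp [toCone]
  right_inv' a ha := by
    have h : ratio k (a 2 - a 0 + center k) ≠ 0 := by
      refine ratio_ne_zero ?_
      rwa [add_sub_cancel_right]
    simp only [toCone, ofCone]
    ext i
    fin_cases i <;> simp [div_mul_cancel₀ _ h]
  open_source := isOpen_lt (by fun_prop) continuous_const
  open_target := isOpen_coneSlab
  continuousOn_toFun := (contDiff_toCone k).continuous.continuousOn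
  continuousOn_invFun := (contDiffOn_ofCone k).continuousOn

/-- The product of the two light-cone combinations is `(v - center k) · ratio k v · (ξ - height v) =
sin 2v · (ξ - height v)`, the right-hand side of the factored surface equation. -/
theorem toCone_mem_iff (k : ℤ) {p : EuclideanSpace ℝ (Fin 3)} :
    toCone k p ∈ doubleCone 2 ↔ p ∈ surface := by
  rw [mem_doubleCone_two_iff, mem_surface_iff, toCone_sub, toCone_add, ← ratio_mul k]
  change p 1 ^ 2 = _ ↔ _
  constructor <;> intro h <;> linear_combination h

theorem ofCone_mem {k : ℤ} {a : EuclideanSpace ℝ (Fin 3)} (ha : a ∈ coneSlab)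
    (h : a ∈ doubleCone 2) : ofCone k a ∈ surface := by
  rw [← toCone_mem_iff k]
  rwa [show toCone k (ofCone k a) = a from (ambientChart k).right_inv ha]

theorem zero_mem_surface : (0 : EuclideanSpace ℝ (Fin 3)) ∈ surface := by
  simp [mem_surface_iff]

open Classical in
/-- The chart of the surface induced by `toCone k`. -/
def surfaceChart (k : ℤ) : OpenPartialHomeomorph surface (doubleCone 2) where
  toFun p := ⟨toCone k p, (toCone_mem_iff k).2 p.2⟩
  -- The default value is never taken on the target, where `ofCone k` maps the cone into the
  -- surface.
  invFun a := if h : ofCone k a ∈ surface then ⟨ofCone k a, h⟩ else ⟨0, zero_mem_surface⟩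
  source := Subtype.val ⁻¹' (ambientChart k).source
  target := Subtype.val ⁻¹' coneSlab
  map_source' p hp := (ambientChart k).map_source hp
  map_target' a ha := by
    rw [dif_pos (ofCone_mem ha a.2)]
    exact (ambientChart k).map_target ha
  left_inv' p hp := by
    have h : ofCone k (toCone k p) = p := (ambientChart k).left_inv hp
    simp only [h, Subtype.coe_prop, dif_pos, Subtype.coe_eta]
  right_inv' a ha := by
    simp only [dif_pos (ofCone_mem ha a.2)]
    exact Subtype.ext ((ambientChart k).right_inv ha)
  open_source := (ambientChart k).open_source.preimage continuous_subtype_val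
  open_target := isOpen_coneSlab.preimage continuous_subtype_val
  continuousOn_toFun :=
    (((contDiff_toCone k).continuous.comp continuous_subtype_val).subtype_mk _).continuousOn
  continuousOn_invFun := by
    refine Topology.IsInducing.subtypeVal.continuousOn_iff.2 ?_
    refine ((contDiffOn_ofCone k).continuousOn.comp continuous_subtype_val.continuousOn
      (s := Subtype.val ⁻¹' coneSlab) fun a ha => ha).congr fun a ha => ?_
    have ha' : a.1 ∈ coneSlab := ha
    simp only [Function.comp, dif_pos (ofCone_mem ha' a.2)]

theorem surfaceChart_apply (k : ℤ) (p : surface) :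
    (surfaceChart k p : EuclideanSpace ℝ (Fin 3)) = toCone k p := rfl

open Classical in
theorem surfaceChart_symm_apply (k : ℤ) {a : doubleCone 2}
    (ha : (a : EuclideanSpace ℝ (Fin 3)) ∈ coneSlab) :
    ((surfaceChart k).symm a : EuclideanSpace ℝ (Fin 3)) = ofCone k a := by
  change ((if h : ofCone k a ∈ surface then ⟨ofCone k a, h⟩ else ⟨0, zero_mem_surface⟩ : surface) :
    EuclideanSpace ℝ (Fin 3)) = _
  rw [dif_pos (ofCone_mem ha a.2)]

theorem mem_surfaceChart_target {k : ℤ} {a : doubleCone 2} : a ∈ (surfaceChart k).target ↔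
    (a : EuclideanSpace ℝ (Fin 3)) ∈ coneSlab := Iff.rfl

/-- Rounding to the nearest multiple of `π/2` leaves an error of at most `π/4`. -/
theorem exists_center (v : ℝ) : ∃ k : ℤ, |v - center k| < Real.pi / 2 := by
  refine ⟨round (v / (Real.pi / 2)), ?_⟩
  have h := abs_sub_round (v / (Real.pi / 2))
  have hp := Real.pi_pos
  have h2 : v - center (round (v / (Real.pi / 2))) =
      (v / (Real.pi / 2) - round (v / (Real.pi / 2))) * (Real.pi / 2) := by
    simp only [center]
    field_simp
  rw [h2, abs_mul, abs_of_pos (by positivity : 0 < Real.pi / 2)]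
  nlinarith

theorem exists_mem_surfaceChart_source (p : surface) : ∃ k, p ∈ (surfaceChart k).source :=
  exists_center _

end LH

/-! ### Analytic maps on the cone and restriction of coordinates -/

/-- A map that is, on the trace of an open set, the restriction of an analytic map is analytic
on the double cone. -/
theorem ConeAnalyticOn.of_contDiffOn {m : ℕ} {F : Type*} [NormedAddCommGroup F] [NormedSpace ℝ F]
    [CompleteSpace F]
    {g : doubleCone m → F} {U : Set (doubleCone m)} {Ω : Set (EuclideanSpace ℝ (Fin (m + 1)))}
    {G : EuclideanSpace ℝ (Fin (m + 1)) → F} (hΩ : IsOpen Ω) (hG : ContDiffOn ℝ ω G Ω)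
    (hU : IsOpen U) (hUΩ : ∀ a ∈ U, (a : EuclideanSpace ℝ (Fin (m + 1))) ∈ Ω)
    (hg : ∀ a ∈ U, G a = g a) : ConeAnalyticOn g U := by
  obtain ⟨V, hV, rfl⟩ := isOpen_induced_iff.1 hU
  refine ⟨V ∩ Ω, hV.inter hΩ, ?_, G, ?_, hg⟩
  · ext a
    exact ⟨fun h => h.1, fun h => ⟨h, hUΩ a h⟩⟩
  · intro a ha
    exact (hG.contDiffAt (hΩ.mem_nhds ha.2)).analyticAt

theorem ConeAnalyticOn.mono {m : ℕ} {F : Type*} [NormedAddCommGroup F] [NormedSpace ℝ F]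
    {g g' : doubleCone m → F} {U V : Set (doubleCone m)} (h : ConeAnalyticOn g U) (hV : IsOpen V)
    (hVU : V ⊆ U) (hg : ∀ a ∈ V, g a = g' a) : ConeAnalyticOn g' V := by
  obtain ⟨Ω, hΩ, rfl, G, hG, hGg⟩ := h
  obtain ⟨W, hW, rfl⟩ := isOpen_induced_iff.1 hV
  refine ⟨W ∩ Ω, hW.inter hΩ, ?_, G, fun a ha => hG a ha.2, fun a ha => ?_⟩
  · ext a
    exact ⟨fun h => h.1, fun h => ⟨h, hVU h⟩⟩
  · rw [hGg a (hVU ha), hg a ha]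

/-- Regular points need a coordinate system whose whole domain is mapped into the domain of the
straightening diffeomorphism, so charts have to be shrunk. -/
theorem DCStructure.IsCoord.restr {m : ℕ} {X : Type*} [TopologicalSpace X] {D : DCStructure m X}
    {ψ : OpenPartialHomeomorph X (doubleCone m)} (h : D.IsCoord ψ) (s : Set X) :
    D.IsCoord (ψ.restr s) := by
  intro φ hφ
  obtain ⟨h1, h2⟩ := h φ hφ
  refine ⟨h1.mono (OpenPartialHomeomorph.open_source _) ?_ fun _ _ => rfl,
    h2.mono (OpenPartialHomeomorph.open_source _) ?_ fun _ _ => rfl⟩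
  · intro a ha
    exact ⟨ha.1.1, ha.2⟩
  · intro a ha
    exact ⟨ha.1, ha.2.1⟩

theorem DCStructure.isCoord_of_mem {m : ℕ} {X : Type*} [TopologicalSpace X] {D : DCStructure m X}
    {φ : OpenPartialHomeomorph X (doubleCone m)} (h : φ ∈ D.charts) : D.IsCoord φ :=
  fun ψ hψ => ⟨D.compatible φ h ψ hψ, D.compatible ψ hψ φ h⟩

/-! ### The DC-structure of the surface -/

namespace LH

theorem isClosed_surface : IsClosed surface := by
  have : Continuous y := contDiff_y.continuous
  exact isClosed_eq (by fun_prop) continuous_const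

/-- The cone and the slab are both star-shaped about the vertex, hence so is their intersection. -/
theorem isConnected_surfaceChart_target (k : ℤ) : IsConnected (surfaceChart k).target := by
  have h0 : (0 : EuclideanSpace ℝ (Fin 3)) ∈ doubleCone 2 := by simp [mem_doubleCone_two_iff]
  have hstar : StarConvex ℝ (0 : EuclideanSpace ℝ (Fin 3)) (doubleCone 2 ∩ coneSlab) := by
    rw [starConvex_zero_iff]
    rintro a ⟨h1, h2⟩ t ht0 ht1
    rw [mem_doubleCone_two_iff] at h1
    have h2' : |a 2 - a 0| < Real.pi / 2 := h2
    refine ⟨?_, ?_⟩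
    · rw [mem_doubleCone_two_iff]
      simp only [PiLp.smul_apply, smul_eq_mul]
      linear_combination t ^ 2 * h1
    · change |(t • a) 2 - (t • a) 0| < _
      simp only [PiLp.smul_apply, smul_eq_mul]
      rw [← mul_sub, abs_mul, abs_of_nonneg ht0]
      nlinarith [abs_nonneg (a 2 - a 0)]
  have h1 : (0 : EuclideanSpace ℝ (Fin 3)) ∈ coneSlab := by
    simp [coneSlab, Real.pi_pos]
  refine ⟨⟨⟨0, h0⟩, h1⟩, Topology.IsInducing.subtypeVal.isPreconnected_image.1 ?_⟩
  have : Subtype.val '' (surfaceChart k).target = doubleCone 2 ∩ coneSlab := by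
    ext a
    simp [mem_surfaceChart_target, and_comm]
  rw [this]
  exact (hstar.isPathConnected ⟨h0, h1⟩).isConnected.isPreconnected

/-- The double-cone structure of the surface. -/
def surfaceDC : DCStructure 2 surface where
  locallyCompact := isClosed_surface.isClosedEmbedding_subtypeVal.locallyCompactSpace
  hausdorff := inferInstance
  secondCountable := inferInstance
  charts := Set.range surfaceChart
  cover p := by
    obtain ⟨k, hk⟩ := exists_mem_surfaceChart_source p
    exact ⟨_, ⟨k, rfl⟩, hk⟩
  connected := by
    rintro _ ⟨k, rfl⟩
    exact isConnected_surfaceChart_target k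
  compatible := by
    rintro _ ⟨k, rfl⟩ _ ⟨l, rfl⟩
    refine .of_contDiffOn isOpen_coneSlab
      ((contDiff_toCone l).comp_contDiffOn (contDiffOn_ofCone k))
      (OpenPartialHomeomorph.open_source _) (fun a ha => ha.1) fun a ha => ?_
    simp only [surfaceChart_apply, Function.comp, surfaceChart_symm_apply k ha.1]

theorem isCoord_surfaceChart (k : ℤ) : surfaceDC.IsCoord (surfaceChart k) :=
  DCStructure.isCoord_of_mem ⟨k, rfl⟩

theorem zeroPad_self (a : EuclideanSpace ℝ (Fin 3)) : DCStructure.zeroPad 2 3 a = a := by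
  ext i
  simp [DCStructure.zeroPad]

/-- The straightening diffeomorphism is `ambientChart k` itself; the zero padding is trivial because
the cone already lives in 3-space. -/
theorem isDCImmersion_inclusion :
    surfaceDC.IsDCImmersion 3 (fun p : surface => (p : EuclideanSpace ℝ (Fin 3))) := by
  refine ⟨by norm_num, ?_, fun p => ?_⟩
  · rintro _ ⟨k, rfl⟩ ψ hψ
    obtain rfl : ψ = OpenPartialHomeomorph.refl _ := hψ
    refine .of_contDiffOn isOpen_coneSlab (contDiffOn_ofCone k) ?_ (fun a ha => ha.1) fun a ha => ?_
    · convert (surfaceChart k).open_target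
      simp
    · exact (surfaceChart_symm_apply k ha.1).symm
  · obtain ⟨k, hk⟩ := exists_mem_surfaceChart_source p
    refine ⟨surfaceChart k, ambientChart k, isCoord_surfaceChart k, hk, hk, ?_, ?_, fun q hq =>
      ⟨hq, ?_⟩⟩
    · exact (contDiff_toCone k).contMDiff.contMDiffOn
    · exact (contDiffOn_ofCone k).contMDiffOn
    · rw [zeroPad_self]
      rfl

end LH

/-! ### Invariance of the vertex and the set of DC-points -/

/-- A linear map vanishing on the double cone vanishes. -/
theorem eq_zero_of_forall_mem_doubleCone {F : Type*} [AddCommGroup F] [Module ℝ F]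
    (A : EuclideanSpace ℝ (Fin 3) →ₗ[ℝ] F) (h : ∀ a ∈ doubleCone 2, A a = 0) : A = 0 := by
  ext a
  -- Expansion in a basis consisting of three vectors of the cone.
  have e : a = ((a 2 - a 1 + a 0) / 2) • !₂[(1 : ℝ), 0, 1] +
      ((a 2 - a 1 - a 0) / 2) • !₂[(-1 : ℝ), 0, 1] + a 1 • !₂[(0 : ℝ), 1, 1] := by
    ext i
    fin_cases i <;> simp <;> ring
  rw [e, map_add, map_add, map_smul, map_smul, map_smul, h, h, h] <;>
    simp [LH.mem_doubleCone_two_iff]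

/-- The vertex of the double cone is preserved by changes of coordinates. -/
theorem DCStructure.IsDCPoint.apply_eq_zero {X : Type*} [TopologicalSpace X] {D : DCStructure 2 X}
    {p : X} (hp : D.IsDCPoint p) {φ : OpenPartialHomeomorph X (doubleCone 2)} (hφ : φ ∈ D.charts)
    (hpφ : p ∈ φ.source) : (φ p : EuclideanSpace ℝ (Fin 3)) = 0 := by
  obtain ⟨ψ, hψ, hpψ, h0⟩ := hp
  obtain ⟨⟨Ω, hΩ, hΩs, G, hG, hGe⟩, ⟨Ω', hΩ', hΩs', H, hH, hHe⟩⟩ := hψ φ hφ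
  beta_reduce at hGe hHe
  have hmem0 : ψ p ∈ (ψ.symm.trans φ).source := by simp [hpψ, hpφ]
  have hG0 : G 0 = φ p := by rw [← h0, hGe _ hmem0, ψ.left_inv hpψ]
  have h0Ω : (0 : EuclideanSpace ℝ (Fin 3)) ∈ Ω := by
    rw [← hΩs] at hmem0
    rw [← h0]
    exact hmem0
  have hmem1 : φ p ∈ (φ.symm.trans ψ).source := by simp [hpψ, hpφ]
  have h1Ω : (φ p : EuclideanSpace ℝ (Fin 3)) ∈ Ω' := by
    rw [← hΩs'] at hmem1
    exact hmem1
  set q : EuclideanSpace ℝ (Fin 3) := (φ p).1 with hq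
  have hG' := (hG 0 h0Ω).differentiableAt.hasFDerivAt
  have hH' := (hH q h1Ω).differentiableAt.hasFDerivAt
  set A := fderiv ℝ G 0
  set B := fderiv ℝ H q
  -- The cone is invariant under scaling, so the line through the vertex and any of its points stays
  -- in it. Along such lines the extensions `G` and `H` of the two transition maps can be compared,
  -- although they are related to each other only on the cone.
  have hline : ∀ a ∈ doubleCone 2, ∀ᶠ t : ℝ in 𝓝 0,
      G (t • a) ∈ doubleCone 2 ∧ H (G (t • a)) = t • a := by
    intro a ha
    have hc : ContinuousAt (fun t : ℝ => t • a) 0 := by fun_prop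
    filter_upwards [hc.preimage_mem_nhds (by rw [zero_smul]; exact hΩ.mem_nhds h0Ω)] with t ht
    have htc : t • a ∈ doubleCone 2 := by
      rw [LH.mem_doubleCone_two_iff] at ha ⊢
      simp only [PiLp.smul_apply, smul_eq_mul]
      linear_combination t ^ 2 * ha
    have hts : (⟨t • a, htc⟩ : doubleCone 2) ∈ (ψ.symm.trans φ).source := by
      rw [← hΩs]
      exact ht
    have e := hGe _ hts
    change G (t • a) = _ at e
    have hts2 := hts
    rw [OpenPartialHomeomorph.trans_source] at hts2
    have hts' : φ (ψ.symm ⟨t • a, htc⟩) ∈ (φ.symm.trans ψ).source := by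
      rw [OpenPartialHomeomorph.trans_source]
      refine ⟨φ.map_source hts2.2, ?_⟩
      rw [Set.mem_preimage, φ.left_inv hts2.2]
      exact ψ.map_target hts2.1
    refine ⟨by rw [e]; exact Subtype.prop _, ?_⟩
    rw [e, hHe _ hts', φ.left_inv hts2.2, ψ.right_inv hts2.1]
  have hGline : ∀ a, HasDerivAt (fun t : ℝ => G (t • a)) (A a) 0 := by
    intro a
    have h1 : HasDerivAt (fun t : ℝ => t • a) a 0 := by
      simpa using (hasDerivAt_id (0 : ℝ)).smul_const a
    have h2 : HasFDerivAt G A ((0 : ℝ) • a) := by rwa [zero_smul]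
    exact h2.comp_hasDerivAt (0 : ℝ) h1
  -- Differentiating `H (G (t • a)) = t • a` gives this on the cone, which spans the space. So `A`
  -- is invertible.
  have hBA : ∀ a, B (A a) = a := by
    have : (B.comp A - ContinuousLinearMap.id ℝ _).toLinearMap = 0 := by
      refine eq_zero_of_forall_mem_doubleCone _ fun a ha => ?_
      have h2 : HasFDerivAt H B (G ((0 : ℝ) • a)) := by rwa [zero_smul, hG0]
      have h3 := h2.comp_hasDerivAt (0 : ℝ) (hGline a)
      have h4 : HasDerivAt (fun t : ℝ => t • a) a 0 := by
        simpa using (hasDerivAt_id (0 : ℝ)).smul_const a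
      have h5 := h3.unique (h4.congr_of_eventuallyEq ((hline a ha).mono fun t ht => ht.2))
      simp [h5]
    intro a
    have := LinearMap.congr_fun this a
    simpa [sub_eq_zero] using this
  have hsurj : Function.Surjective A := by
    have hinj : Function.Injective A.toLinearMap := Function.LeftInverse.injective (g := B) hBA
    exact LinearMap.injective_iff_surjective.1 hinj
  -- The quadratic form of the cone vanishes along `G (t • a)`; its derivative at `t = 0` says that
  -- `q` is orthogonal to `A a`. As `A` is onto, `q` is orthogonal to everything, and the form is
  -- non-degenerate, so `q = 0`.
  have hQ : ∀ d : EuclideanSpace ℝ (Fin 3), q 0 * d 0 + q 1 * d 1 - q 2 * d 2 = 0 := by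
    let ℓ : EuclideanSpace ℝ (Fin 3) →ₗ[ℝ] ℝ :=
      { toFun := fun d => q 0 * d 0 + q 1 * d 1 - q 2 * d 2
        map_add' := fun d d' => by simp; ring
        map_smul' := fun c d => by simp; ring }
    have : ℓ ∘ₗ A.toLinearMap = 0 := by
      refine eq_zero_of_forall_mem_doubleCone _ fun a ha => ?_
      have hd := (hGline a)
      have hi : ∀ i, HasDerivAt (fun t : ℝ => G (t • a) i) (A a i) 0 := fun i =>
        (EuclideanSpace.proj (𝕜 := ℝ) i).hasFDerivAt.comp_hasDerivAt (0 : ℝ) hd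
      have h1 := (((hi 0).pow 2).add ((hi 1).pow 2)).sub ((hi 2).pow 2)
      have h2 := h1.unique ((hasDerivAt_const (0 : ℝ) (0 : ℝ)).congr_of_eventuallyEq
        ((hline a ha).mono fun t ht => by
          have := LH.mem_doubleCone_two_iff.1 ht.1
          simp only [Pi.add_apply, Pi.sub_apply, Pi.pow_apply]
          linear_combination this))
      simp only [zero_smul, hG0] at h2
      change q 0 * (A a) 0 + q 1 * (A a) 1 - q 2 * (A a) 2 = 0
      norm_num at h2
      linarith
    intro d
    obtain ⟨a, rfl⟩ := hsurj d
    exact LinearMap.congr_fun this a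
  have h1 := hQ !₂[1, 0, 0]
  have h2 := hQ !₂[0, 1, 0]
  have h3 := hQ !₂[0, 0, 1]
  simp at h1 h2 h3
  ext i
  fin_cases i <;> simp [h1, h2, h3]

namespace LH

theorem isDCPoint_iff {p : surface} : surfaceDC.IsDCPoint p ↔
    ∃ k, (p : EuclideanSpace ℝ (Fin 3)) = ofCone k 0 := by
  constructor
  · intro h
    obtain ⟨k, hk⟩ := exists_mem_surfaceChart_source p
    refine ⟨k, ?_⟩
    have h2 : toCone k p = 0 := h.apply_eq_zero ⟨k, rfl⟩ hk
    rw [← h2]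
    exact ((ambientChart k).left_inv hk).symm
  · rintro ⟨k, hk⟩
    have h0 : (0 : EuclideanSpace ℝ (Fin 3)) ∈ coneSlab := by simp [coneSlab, Real.pi_pos]
    refine ⟨surfaceChart k, isCoord_surfaceChart k, ?_, ?_⟩
    · change (p : EuclideanSpace ℝ (Fin 3)) ∈ (ambientChart k).source
      rw [hk]
      exact (ambientChart k).map_target h0
    · rw [surfaceChart_apply, hk]
      exact (ambientChart k).right_inv h0

theorem ofCone_zero_apply_two (k : ℤ) : ofCone k 0 2 = center k := by simp [ofCone]

theorem ofCone_zero_mem (k : ℤ) : ofCone k 0 ∈ surface :=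
  ofCone_mem (by simp [coneSlab, Real.pi_pos]) (by simp [mem_doubleCone_two_iff])

theorem center_injective : Function.Injective center := by
  intro k l h
  simp only [center] at h
  have hp := Real.pi_ne_zero
  field_simp at h
  exact_mod_cast h

theorem setOf_isDCPoint :
    {p | surfaceDC.IsDCPoint p} = Set.range fun k => (⟨ofCone k 0, ofCone_zero_mem k⟩ : surface) := by
  ext p
  simp only [Set.mem_ofPred_eq, isDCPoint_iff, Set.mem_range, Subtype.ext_iff, eq_comm]

theorem countable_isDCPoint : {p | surfaceDC.IsDCPoint p}.Countable := by
  rw [setOf_isDCPoint]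
  exact Set.countable_range _

theorem infinite_isDCPoint : {p | surfaceDC.IsDCPoint p}.Infinite := by
  rw [setOf_isDCPoint]
  refine Set.infinite_range_of_injective fun k l h => center_injective ?_
  rw [← ofCone_zero_apply_two, ← ofCone_zero_apply_two]
  exact congrArg (fun p : surface => (p : EuclideanSpace ℝ (Fin 3)) 2) h

theorem sin_two_mul_center (k : ℤ) : Real.sin (2 * center k) = 0 := by
  rw [show 2 * center k = k * Real.pi by simp only [center]; ring, Real.sin_int_mul_pi]

end LH

/-! ### Derivatives and mean curvature of the catenoid -/

theorem fderiv_apply_one_zero {g : ℝ × ℝ → EuclideanSpace ℝ (Fin 4)} {z : ℝ × ℝ}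
    {d : EuclideanSpace ℝ (Fin 4)} (hg : DifferentiableAt ℝ g z)
    (h : ∀ i, HasDerivAt (fun t => g (t, z.2) i) (d i) z.1) : fderiv ℝ g z (1, 0) = d := by
  ext i
  have h1 : HasDerivAt (fun t : ℝ => (t, z.2)) ((1 : ℝ), (0 : ℝ)) z.1 :=
    (hasDerivAt_id z.1).prodMk (hasDerivAt_const _ _)
  have h2 := hg.hasFDerivAt.comp_hasDerivAt z.1 h1
  exact ((EuclideanSpace.proj (𝕜 := ℝ) i).hasFDerivAt.comp_hasDerivAt z.1 h2).unique (h i)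

theorem fderiv_apply_zero_one {g : ℝ × ℝ → EuclideanSpace ℝ (Fin 4)} {z : ℝ × ℝ}
    {d : EuclideanSpace ℝ (Fin 4)} (hg : DifferentiableAt ℝ g z)
    (h : ∀ i, HasDerivAt (fun t => g (z.1, t) i) (d i) z.2) : fderiv ℝ g z (0, 1) = d := by
  ext i
  have h1 : HasDerivAt (fun t : ℝ => (z.1, t)) ((0 : ℝ), (1 : ℝ)) z.2 :=
    (hasDerivAt_const _ _).prodMk (hasDerivAt_id z.2)
  have h2 := hg.hasFDerivAt.comp_hasDerivAt z.2 h1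
  exact ((EuclideanSpace.proj (𝕜 := ℝ) i).hasFDerivAt.comp_hasDerivAt z.2 h2).unique (h i)

theorem hasDerivAt_quadratic (a b c u : ℝ) :
    HasDerivAt (fun u : ℝ => a + b * u + c * u ^ 2) (b + 2 * c * u) u := by
  have h := (((hasDerivAt_id u).const_mul b).const_add a).add (((hasDerivAt_id u).pow 2).const_mul c)
  refine h.congr_deriv ?_
  simp
  ring

/-- All coordinates of the catenoid and of its first partial derivatives have this shape in `v`, so
one formula serves for all of them. -/
theorem hasDerivAt_quadratic_trig (a b c a' b' c' v : ℝ) :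
    HasDerivAt (fun v : ℝ => (a + b * v + c * v ^ 2) * Real.cos (2 * v) +
      (a' + b' * v + c' * v ^ 2) * Real.sin (2 * v))
      ((b + 2 * c * v + 2 * (a' + b' * v + c' * v ^ 2)) * Real.cos (2 * v) +
        (b' + 2 * c' * v - 2 * (a + b * v + c * v ^ 2)) * Real.sin (2 * v)) v := by
  have h2 : HasDerivAt (fun v : ℝ => 2 * v) 2 v := by simpa using (hasDerivAt_id v).const_mul 2
  have h := ((hasDerivAt_quadratic a b c v).mul h2.cos).add
    ((hasDerivAt_quadratic a' b' c' v).mul h2.sin)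
  refine h.congr_deriv ?_
  ring

namespace LH

/-- The coordinates of the catenoid. -/
def catenoidVec (w : ℝ × ℝ) : EuclideanSpace ℝ (Fin 4) :=
  !₂[w.2 * Real.cos (2 * w.2) + (w.1 ^ 2 + w.2 ^ 2) / 2 * Real.sin (2 * w.2),
    w.1 * Real.sin (2 * w.2),
    Real.cos (2 * w.2) + w.2 * Real.sin (2 * w.2),
    w.2 * Real.cos (2 * w.2) + (w.1 ^ 2 + w.2 ^ 2 - 2) / 2 * Real.sin (2 * w.2)]

/-- The partial derivative of `catenoidVec` in the first variable. -/
def catenoidVecU (w : ℝ × ℝ) : EuclideanSpace ℝ (Fin 4) :=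
  !₂[w.1 * Real.sin (2 * w.2), Real.sin (2 * w.2), 0, w.1 * Real.sin (2 * w.2)]

/-- The partial derivative of `catenoidVec` in the second variable. -/
def catenoidVecV (w : ℝ × ℝ) : EuclideanSpace ℝ (Fin 4) :=
  !₂[(1 + w.1 ^ 2 + w.2 ^ 2) * Real.cos (2 * w.2) - w.2 * Real.sin (2 * w.2),
    2 * w.1 * Real.cos (2 * w.2),
    2 * w.2 * Real.cos (2 * w.2) - Real.sin (2 * w.2),
    (w.1 ^ 2 + w.2 ^ 2 - 1) * Real.cos (2 * w.2) - w.2 * Real.sin (2 * w.2)]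

theorem coe_catenoid (w : ℝ × ℝ) : (catenoid w : EuclideanSpace ℝ (Fin 4)) = catenoidVec w := by
  ext i
  fin_cases i <;>
    simp [catenoid, catenoidVec, P, profile, y] <;> ring

@[fun_prop]
theorem contDiff_catenoidVec : ContDiff ℝ ω catenoidVec := by
  refine contDiff_euclidean.2 fun i => ?_
  fin_cases i <;> simp [catenoidVec] <;> fun_prop

theorem differentiable_catenoidVec : Differentiable ℝ catenoidVec :=
  contDiff_catenoidVec.differentiable (by simp)

theorem differentiable_catenoidVecU : Differentiable ℝ catenoidVecU := by
  refine ContDiff.differentiable (n := ω) (contDiff_euclidean.2 fun i => ?_) (by simp)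
  fin_cases i <;> simp [catenoidVecU] <;> fun_prop

theorem differentiable_catenoidVecV : Differentiable ℝ catenoidVecV := by
  refine ContDiff.differentiable (n := ω) (contDiff_euclidean.2 fun i => ?_) (by simp)
  fin_cases i <;> simp [catenoidVecV] <;> fun_prop

theorem fderiv_catenoidVec_one_zero (z : ℝ × ℝ) :
    fderiv ℝ catenoidVec z (1, 0) = catenoidVecU z := by
  refine fderiv_apply_one_zero (differentiable_catenoidVec z) fun i => ?_
  obtain ⟨u, v⟩ := z
  fin_cases i
  · convert hasDerivAt_quadratic (v * Real.cos (2 * v) + v ^ 2 / 2 * Real.sin (2 * v)) 0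
      (Real.sin (2 * v) / 2) u using 1
    · funext t; simp [catenoidVec, -mul_eq_mul_right_iff]; ring
    · simp [catenoidVecU]; ring
  · convert hasDerivAt_quadratic 0 (Real.sin (2 * v)) 0 u using 1
    · funext t; simp [catenoidVec, -mul_eq_mul_right_iff]; ring
    · simp [catenoidVecU]
  · simpa [catenoidVec, catenoidVecU] using hasDerivAt_const u _
  · convert hasDerivAt_quadratic (v * Real.cos (2 * v) + (v ^ 2 - 2) / 2 * Real.sin (2 * v)) 0
      (Real.sin (2 * v) / 2) u using 1
    · funext t; simp [catenoidVec, -mul_eq_mul_right_iff]; ring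
    · simp [catenoidVecU]; ring

theorem fderiv_catenoidVec_zero_one (z : ℝ × ℝ) :
    fderiv ℝ catenoidVec z (0, 1) = catenoidVecV z := by
  refine fderiv_apply_zero_one (differentiable_catenoidVec z) fun i => ?_
  obtain ⟨u, v⟩ := z
  fin_cases i
  · convert hasDerivAt_quadratic_trig 0 1 0 (u ^ 2 / 2) 0 (1 / 2) v using 1
    · funext t; simp [catenoidVec, -mul_eq_mul_right_iff]; ring
    · simp [catenoidVecV]; ring
  · convert hasDerivAt_quadratic_trig 0 0 0 u 0 0 v using 1
    · funext t; simp [catenoidVec]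
    · simp [catenoidVecV]
  · convert hasDerivAt_quadratic_trig 1 0 0 0 1 0 v using 1
    · funext t; simp [catenoidVec]
    · simp [catenoidVecV, -mul_eq_mul_right_iff]; ring
  · convert hasDerivAt_quadratic_trig 0 1 0 (u ^ 2 / 2 - 1) 0 (1 / 2) v using 1
    · funext t; simp [catenoidVec, -mul_eq_mul_right_iff]; ring
    · simp [catenoidVecV]; ring

theorem fderiv_catenoidVecU_one_zero (z : ℝ × ℝ) : fderiv ℝ catenoidVecU z (1, 0) =
    !₂[Real.sin (2 * z.2), 0, 0, Real.sin (2 * z.2)] := by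
  refine fderiv_apply_one_zero (differentiable_catenoidVecU z) fun i => ?_
  obtain ⟨u, v⟩ := z
  fin_cases i
  · convert hasDerivAt_quadratic 0 (Real.sin (2 * v)) 0 u using 1
    · funext t; simp [catenoidVecU]; ring
    · simp
  · simpa [catenoidVecU] using hasDerivAt_const u _
  · simpa [catenoidVecU] using hasDerivAt_const u _
  · convert hasDerivAt_quadratic 0 (Real.sin (2 * v)) 0 u using 1
    · funext t; simp [catenoidVecU]; ring
    · simp

theorem fderiv_catenoidVecU_zero_one (z : ℝ × ℝ) : fderiv ℝ catenoidVecU z (0, 1) =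
    !₂[2 * z.1 * Real.cos (2 * z.2), 2 * Real.cos (2 * z.2), 0,
      2 * z.1 * Real.cos (2 * z.2)] := by
  refine fderiv_apply_zero_one (differentiable_catenoidVecU z) fun i => ?_
  obtain ⟨u, v⟩ := z
  fin_cases i
  · convert hasDerivAt_quadratic_trig 0 0 0 u 0 0 v using 1
    · funext t; simp [catenoidVecU]
    · simp
  · convert hasDerivAt_quadratic_trig 0 0 0 1 0 0 v using 1
    · funext t; simp [catenoidVecU]
    · simp
  · simpa [catenoidVecU] using hasDerivAt_const v _
  · convert hasDerivAt_quadratic_trig 0 0 0 u 0 0 v using 1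
    · funext t; simp [catenoidVecU]
    · simp

theorem fderiv_catenoidVecV_zero_one (z : ℝ × ℝ) : fderiv ℝ catenoidVecV z (0, 1) =
    !₂[-(3 + 2 * (z.1 ^ 2 + z.2 ^ 2)) * Real.sin (2 * z.2), -4 * z.1 * Real.sin (2 * z.2),
      -4 * z.2 * Real.sin (2 * z.2), (1 - 2 * (z.1 ^ 2 + z.2 ^ 2)) * Real.sin (2 * z.2)] := by
  refine fderiv_apply_zero_one (differentiable_catenoidVecV z) fun i => ?_
  obtain ⟨u, v⟩ := z
  fin_cases i
  · convert hasDerivAt_quadratic_trig (1 + u ^ 2) 0 1 0 (-1) 0 v using 1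
    · funext t; simp [catenoidVecV]; ring
    · simp [-mul_eq_mul_right_iff]; ring
  · convert hasDerivAt_quadratic_trig (2 * u) 0 0 0 0 0 v using 1
    · funext t; simp [catenoidVecV]
    · simp [-mul_eq_mul_right_iff]; ring
  · convert hasDerivAt_quadratic_trig 0 2 0 (-1) 0 0 v using 1
    · funext t; simp [catenoidVecV]; ring
    · simp [-mul_eq_mul_right_iff]; ring
  · convert hasDerivAt_quadratic_trig (u ^ 2 - 1) 0 1 0 (-1) 0 v using 1
    · funext t; simp [catenoidVecV]; ring
    · simp [-mul_eq_mul_right_iff]; ring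

/-- The unit normal vector of the catenoid. -/
def catenoidNormal (w : ℝ × ℝ) : EuclideanSpace ℝ (Fin 4) :=
  !₂[(1 + w.1 ^ 2 + w.2 ^ 2) / Real.sin (2 * w.2), 2 * w.1 / Real.sin (2 * w.2),
    2 * w.2 / Real.sin (2 * w.2), (w.1 ^ 2 + w.2 ^ 2 - 1) / Real.sin (2 * w.2)] - catenoidVec w

/-- The parametrization is conformal, `E = G = sin² 2v` and `F = 0`, so the claim on the curvature
is `L + N = 2 sin² 2v`. -/
theorem isSpacelikeCMCOneAt_catenoidVec {w : ℝ × ℝ} (hw : Real.sin (2 * w.2) ≠ 0) :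
    IsSpacelikeCMCOneAt catenoidVec w (catenoidNormal w) := by
  have hsc := Real.sin_sq_add_cos_sq (2 * w.2)
  have hE : lorentz (catenoidVecU w) (catenoidVecU w) = Real.sin (2 * w.2) ^ 2 := by
    simp [lorentz, catenoidVecU]
    ring
  have hF : lorentz (catenoidVecU w) (catenoidVecV w) = 0 := by
    simp [lorentz, catenoidVecU, catenoidVecV]
    ring
  have hG : lorentz (catenoidVecV w) (catenoidVecV w) = Real.sin (2 * w.2) ^ 2 := by
    simp [lorentz, catenoidVecV]
    ring
  have hs2 : 0 < Real.sin (2 * w.2) ^ 2 := by positivity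
  simp only [IsSpacelikeCMCOneAt, fderiv_catenoidVec_one_zero, fderiv_catenoidVec_zero_one]
  rw [show (fun z => catenoidVecU z) = catenoidVecU from rfl,
    show (fun z => catenoidVecV z) = catenoidVecV from rfl, fderiv_catenoidVecU_one_zero,
    fderiv_catenoidVecU_zero_one, fderiv_catenoidVecV_zero_one, hE, hF, hG]
  simp only [catenoidNormal, catenoidVec, catenoidVecU, catenoidVecV]
  clear hE hF hG
  generalize Real.sin (2 * w.2) = s at *
  generalize Real.cos (2 * w.2) = c at *
  refine ⟨hs2, by nlinarith, ?_, ?_, ?_, ?_, ?_⟩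
  · simp [lorentz]
    field_simp
    linear_combination (4 * s ^ 2) * hsc
  · simp [lorentz]
    field_simp
    linear_combination (-4 * s) * hsc
  · simp [lorentz]
    field_simp
    ring
  · simp [lorentz]
    field_simp
    ring
  · simp [lorentz]
    field_simp
    ring

/-! ### The extension away from the light-like lines -/

/-- The surface, parametrized over the plane except for the points with `sin 2v = 0`. -/
def paramVec (w : ℝ × ℝ) : EuclideanSpace ℝ (Fin 3) :=
  !₂[height w.2 + w.1 ^ 2 * Real.sin (2 * w.2), w.1 * Real.sin (2 * w.2), w.2]

theorem paramVec_mem (w : ℝ × ℝ) : paramVec w ∈ surface := by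
  simp [mem_surface_iff, paramVec]
  ring

theorem contDiff_paramVec : ContDiff ℝ ω paramVec := by
  refine contDiff_euclidean.2 fun i => ?_
  fin_cases i <;> simp [paramVec] <;> fun_prop

/-- `paramVec` as a map into the surface. -/
def param (w : ℝ × ℝ) : surface := ⟨paramVec w, paramVec_mem w⟩

/-- The coordinate expression of the extension on the ambient space. -/
def extensionVec (p : EuclideanSpace ℝ (Fin 3)) : EuclideanSpace ℝ (Fin 4) :=
  !₂[(p 0 + Real.sin (2 * p 2)) / 2, p 1, y (p 2), (p 0 - Real.sin (2 * p 2)) / 2]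

theorem coe_extension (p : surface) :
    (extension p : EuclideanSpace ℝ (Fin 4)) = extensionVec p := rfl

@[fun_prop]
theorem contDiff_extensionVec : ContDiff ℝ ω extensionVec := by
  refine contDiff_euclidean.2 fun i => ?_
  fin_cases i <;> simp [extensionVec] <;> fun_prop

theorem extension_param (w : ℝ × ℝ) : extension (param w) = catenoid w := by
  refine Subtype.ext ?_
  rw [coe_extension, coe_catenoid]
  ext i
  fin_cases i <;> simp [param, paramVec, extensionVec, catenoidVec, height, y] <;> ring

/-- With `u = x / sin 2v` the factored surface equation can be solved for `ξ = height v + u² sin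
2v`. -/
theorem param_eq {p : surface} (h : Real.sin (2 * (p : EuclideanSpace ℝ (Fin 3)) 2) ≠ 0) :
    param ((p : EuclideanSpace ℝ (Fin 3)) 1 / Real.sin (2 * (p : EuclideanSpace ℝ (Fin 3)) 2),
      (p : EuclideanSpace ℝ (Fin 3)) 2) = p := by
  have hp := mem_surface_iff.1 p.2
  refine Subtype.ext ?_
  ext i
  fin_cases i
  · simp [param, paramVec]
    field_simp
    linear_combination hp
  · simp [param, paramVec]
    field_simp
  · simp [param, paramVec]

theorem isLocalParam_param {w : ℝ × ℝ} (hw : Real.sin (2 * w.2) ≠ 0) :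
    surfaceDC.IsLocalParam param w := by
  obtain ⟨k, hk⟩ := exists_mem_surfaceChart_source (param w)
  have hc : ContDiff ℝ ω (fun z => toCone k (paramVec z)) :=
    (contDiff_toCone k).comp contDiff_paramVec
  refine ⟨surfaceChart k, isCoord_surfaceChart k, hk,
    (contDiff_paramVec.continuous.subtype_mk paramVec_mem).continuousAt,
    hc.contDiffAt.analyticAt, ?_⟩
  -- A left inverse of the parametrization in cone coordinates, differentiable where `sin 2v ≠ 0`;
  -- by the chain rule the derivative of the parametrization is injective.
  let L : EuclideanSpace ℝ (Fin 3) → ℝ × ℝ := fun a =>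
    (a 1 / Real.sin (2 * (a 2 - a 0 + center k)), a 2 - a 0 + center k)
  have hL : ∀ z : ℝ × ℝ, Real.sin (2 * z.2) ≠ 0 → L (toCone k (paramVec z)) = z := by
    intro z hz
    simp only [L, toCone_sub, sub_add_cancel]
    ext
    · simp [toCone, paramVec, hz]
    · simp [paramVec]
  have hLd : DifferentiableAt ℝ L (toCone k (paramVec w)) := by
    have h : Real.sin (2 * (toCone k (paramVec w) 2 - toCone k (paramVec w) 0 + center k)) ≠ 0 := by
      rw [toCone_sub]
      simpa [paramVec] using hw
    fun_prop (disch := exact h)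
  have hd : DifferentiableAt ℝ (fun z => toCone k (paramVec z)) w :=
    (hc.differentiable (by simp)) w
  have hcomp := hLd.hasFDerivAt.comp w hd.hasFDerivAt
  have hid : HasFDerivAt (L ∘ fun z => toCone k (paramVec z)) (ContinuousLinearMap.id ℝ _) w := by
    refine (hasFDerivAt_id w).congr_of_eventuallyEq ?_
    have : ContinuousAt (fun z : ℝ × ℝ => Real.sin (2 * z.2)) w := by fun_prop
    filter_upwards [this.eventually_ne hw] with z hz
    exact hL z hz
  have he := hcomp.unique hid
  refine Function.LeftInverse.injective (g := fderiv ℝ L (toCone k (paramVec w))) fun d => ?_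
  exact DFunLike.congr_fun he d

theorem mem_line_iff {s : ℝ} {X : deSitter} : X ∈ line s ↔
    (X : EuclideanSpace ℝ (Fin 4)) 0 = (X : EuclideanSpace ℝ (Fin 4)) 3 ∧
    (X : EuclideanSpace ℝ (Fin 4)) 1 = 0 ∧ (X : EuclideanSpace ℝ (Fin 4)) 2 = s := by
  constructor
  · rintro ⟨t, ht⟩
    rw [ht]
    simp
  · rintro ⟨h1, h2, h3⟩
    refine ⟨(X : EuclideanSpace ℝ (Fin 4)) 0, ?_⟩
    ext i
    fin_cases i <;> simp [h1, h2, h3]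

/-- The difference of the outer coordinates of `extension p` is `sin 2v`. When it vanishes, the
surface equation gives `x = 0` and `y_sq` gives `y = ±1`. -/
theorem extension_mem_lines_iff {p : surface} : extension p ∈ line 1 ∪ line (-1) ↔
    Real.sin (2 * (p : EuclideanSpace ℝ (Fin 3)) 2) = 0 := by
  have hp := mem_surface_iff.1 p.2
  have hy := y_sq ((p : EuclideanSpace ℝ (Fin 3)) 2)
  simp only [Set.mem_union, mem_line_iff, coe_extension]
  constructor
  · rintro (⟨h, -⟩ | ⟨h, -⟩) <;> simp [extensionVec] at h <;> linarith
  · intro h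
    rw [h] at hp hy
    have h1 : (p : EuclideanSpace ℝ (Fin 3)) 1 = 0 := by simpa using hp
    have h2 : y ((p : EuclideanSpace ℝ (Fin 3)) 2) = 1 ∨
        y ((p : EuclideanSpace ℝ (Fin 3)) 2) = -1 := 
      mul_self_eq_one_iff.1 (by linarith)
    simpa [extensionVec, h, h1] using h2

theorem isSpacelikeCMCOneOn_extension : surfaceDC.IsSpacelikeCMCOneOn extension
    (extension ⁻¹' (line 1 ∪ line (-1)))ᶜ := by
  have hO : (extension ⁻¹' (line 1 ∪ line (-1)))ᶜ =
      {p : surface | Real.sin (2 * (p : EuclideanSpace ℝ (Fin 3)) 2) ≠ 0} := by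
    ext p
    rw [Set.mem_compl_iff, Set.mem_preimage, extension_mem_lines_iff]
    rfl
  rw [hO]
  have hcont : Continuous fun p : surface => Real.sin (2 * (p : EuclideanSpace ℝ (Fin 3)) 2) := by
    fun_prop
  refine ⟨isOpen_ne_fun hcont continuous_const, fun p hp hdc => ?_,
    -- The parameter `u` is a continuous function of the point off the lines, so the normal of the
    -- catenoid descends to a continuous field there.
    fun p => catenoidNormal ((p : EuclideanSpace ℝ (Fin 3)) 1 /
      Real.sin (2 * (p : EuclideanSpace ℝ (Fin 3)) 2), (p : EuclideanSpace ℝ (Fin 3)) 2), ?_,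
    fun p hp => ?_⟩
  · obtain ⟨k, hk⟩ := isDCPoint_iff.1 hdc
    refine hp ?_
    rw [hk, ofCone_zero_apply_two, sin_two_mul_center]
  · have h1 : ContinuousOn (fun p : surface => ((p : EuclideanSpace ℝ (Fin 3)) 1 /
        Real.sin (2 * (p : EuclideanSpace ℝ (Fin 3)) 2), (p : EuclideanSpace ℝ (Fin 3)) 2))
        {p : surface | Real.sin (2 * (p : EuclideanSpace ℝ (Fin 3)) 2) ≠ 0} :=
      ContinuousOn.prodMk (ContinuousOn.div (by fun_prop) (by fun_prop) fun p hp => hp)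
        (by fun_prop)
    have h2 : ContinuousOn catenoidNormal {w | Real.sin (2 * w.2) ≠ 0} := by
      refine ContinuousOn.sub ?_ contDiff_catenoidVec.continuous.continuousOn
      have hs : ContinuousOn (fun w : ℝ × ℝ => Real.sin (2 * w.2)) {w | Real.sin (2 * w.2) ≠ 0} := by
        fun_prop
      refine (PiLp.continuous_toLp 2 _).comp_continuousOn (continuousOn_pi.2 fun i => ?_)
      fin_cases i
      all_goals exact ContinuousOn.div (by fun_prop) hs fun w hw => hw
    exact h2.comp h1 fun p hp => hp
  · have hp' : Real.sin (2 * (p : EuclideanSpace ℝ (Fin 3)) 2) ≠ 0 := hp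
    have : (fun z => (extension (param z) : EuclideanSpace ℝ (Fin 4))) = catenoidVec := by
      funext z
      rw [extension_param, coe_catenoid]
    refine ⟨param, _, isLocalParam_param (w := (_, _)) hp', param_eq hp', ?_⟩
    rw [this]
    exact isSpacelikeCMCOneAt_catenoidVec hp'

end LH

/-! ### The extension is a DC-immersion -/

/-- The analytic inverse function theorem, for maps with injective derivative between spaces of
the same finite dimension. -/
theorem ContDiff.exists_openPartialHomeomorph {E : Type*} [NormedAddCommGroup E] [NormedSpace ℝ E]
    [FiniteDimensional ℝ E] {f : E → E} (hf : ContDiff ℝ ω f) {p : E}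
    (hinj : ∀ d, fderiv ℝ f p d = 0 → d = 0) :
    ∃ e : OpenPartialHomeomorph E E, p ∈ e.source ∧ (∀ x, e x = f x) ∧
      ContDiffOn ℝ ω e.symm e.target := by
  have : CompleteSpace E := FiniteDimensional.complete ℝ E
  have hinj' : Function.Injective (fderiv ℝ f p).toLinearMap :=
    (injective_iff_map_eq_zero _).2 hinj
  let L : E ≃L[ℝ] E := (LinearEquiv.ofInjectiveEndo _ hinj').toContinuousLinearEquiv
  have hL : HasFDerivAt f (L : E →L[ℝ] E) p :=
    (hf.differentiable (by simp) p).hasFDerivAt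
  let e₀ := hf.contDiffAt.toOpenPartialHomeomorph f hL (by simp)
  have hp : p ∈ e₀.source := hf.contDiffAt.mem_toOpenPartialHomeomorph_source hL (by simp)
  have hs : ContDiffAt ℝ ω e₀.symm (f p) := hf.contDiffAt.to_localInverse hL (by simp)
  -- The local inverse is analytic at one point, hence on a neighbourhood, to which it is
  -- restricted.
  obtain ⟨V, hV, hVo, hpV⟩ := eventually_nhds_iff.1 (hs.eventually (by simp))
  refine ⟨(e₀.symm.restr V).symm, ?_, fun x => rfl, ?_⟩
  · have : p ∈ (e₀.symm.restr V).target := by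
      have h : f p ∈ (e₀.symm.restr V).source := by
        rw [OpenPartialHomeomorph.restr_source, hVo.interior_eq]
        exact ⟨e₀.map_source hp, hpV⟩
      have h2 := (e₀.symm.restr V).map_source h
      rwa [show (e₀.symm.restr V) (f p) = p from e₀.left_inv hp] at h2
    exact this
  · intro b hb
    have hb' : b ∈ (e₀.symm.restr V).source := hb
    rw [OpenPartialHomeomorph.restr_source, hVo.interior_eq] at hb'
    exact (hV b hb'.2).contDiffWithinAt

namespace LH

theorem continuous_extension : Continuous extension :=
  contDiff_extensionVec.continuous.comp continuous_subtype_val |>.subtype_mk _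

theorem isAnalytic_extension : surfaceDC.IsAnalytic 3 extension := by
  rintro _ ⟨k, rfl⟩ _ ⟨j, ε, hε, rfl⟩
  refine .of_contDiffOn isOpen_coneSlab ((deSitter.contDiff_drop j).comp_contDiffOn
    (contDiff_extensionVec.comp_contDiffOn (contDiffOn_ofCone k)))
    ((surfaceChart k).continuousOn_symm.isOpen_inter_preimage (surfaceChart k).open_target
      ((deSitter.chart j ε hε).open_source.preimage continuous_extension))
    (fun a ha => ha.1) fun a ha => ?_
  change _ = deSitter.drop j (extensionVec _)
  rw [surfaceChart_symm_apply k ha.1]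
  rfl

/-- The function that defines the surface. -/
def defining (p : EuclideanSpace ℝ (Fin 3)) : ℝ :=
  -p 0 * Real.sin (2 * p 2) + p 1 ^ 2 + y (p 2) ^ 2 - 1

@[fun_prop]
theorem contDiff_defining : ContDiff ℝ ω defining := by
  unfold defining
  fun_prop

theorem defining_eq_zero {p : EuclideanSpace ℝ (Fin 3)} (hp : p ∈ surface) : defining p = 0 :=
  sub_eq_zero.2 hp

/-- An extension to the ambient space of the coordinate expression of `extension`, chosen such that
it is a local diffeomorphism along the surface. -/
def ambientExtension (j : Fin 3) (p : EuclideanSpace ℝ (Fin 3)) : EuclideanSpace ℝ (Fin 3) :=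
  -- The Lorentz square of `extensionVec p` is `1 + defining p`, so the factor is the first-order
  -- part of the normalization `(1 + defining p)^(-1/2)` onto de Sitter space.
  (1 - defining p / 2) • deSitter.drop j (extensionVec p)

theorem contDiff_ambientExtension (j : Fin 3) : ContDiff ℝ ω (ambientExtension j) :=
  ContDiff.smul (contDiff_const.sub (contDiff_defining.div_const 2)) ((deSitter.contDiff_drop j).comp contDiff_extensionVec)

theorem ambientExtension_of_mem (j : Fin 3) {p : EuclideanSpace ℝ (Fin 3)} (hp : p ∈ surface) :
    ambientExtension j p = deSitter.drop j (extensionVec p) := by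
  simp [ambientExtension, defining_eq_zero hp]

theorem hasDerivAt_y (v : ℝ) :
    HasDerivAt y (2 * v * Real.cos (2 * v) - Real.sin (2 * v)) v := by
  convert hasDerivAt_quadratic_trig 1 0 0 0 1 0 v using 1
  · funext t; simp [y]
  · ring

theorem hasDerivAt_line_apply (p d : EuclideanSpace ℝ (Fin 3)) (i : Fin 3) :
    HasDerivAt (fun t : ℝ => (p + t • d) i) (d i) 0 := by
  have := (((hasDerivAt_id (0 : ℝ)).mul_const (d i)).const_add (p i))
  simpa using this

/-- The differential of `extensionVec`. -/
def extensionDiff (p d : EuclideanSpace ℝ (Fin 3)) : EuclideanSpace ℝ (Fin 4) :=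
  !₂[(d 0 + 2 * Real.cos (2 * p 2) * d 2) / 2, d 1,
    (2 * p 2 * Real.cos (2 * p 2) - Real.sin (2 * p 2)) * d 2,
    (d 0 - 2 * Real.cos (2 * p 2) * d 2) / 2]

theorem hasDerivAt_sin_line (p d : EuclideanSpace ℝ (Fin 3)) :
    HasDerivAt (fun t : ℝ => Real.sin (2 * (p + t • d) 2)) (2 * Real.cos (2 * p 2) * d 2) 0 := by
  have h := ((hasDerivAt_line_apply p d 2).const_mul 2).sin
  refine h.congr_deriv ?_
  simp
  ring

theorem hasDerivAt_y_line (p d : EuclideanSpace ℝ (Fin 3)) :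
    HasDerivAt (fun t : ℝ => y ((p + t • d) 2))
      ((2 * p 2 * Real.cos (2 * p 2) - Real.sin (2 * p 2)) * d 2) 0 := by
  have hy : HasDerivAt y (2 * p 2 * Real.cos (2 * p 2) - Real.sin (2 * p 2))
      ((p + (0 : ℝ) • d) 2) := by
    simpa using hasDerivAt_y (p 2)
  exact hy.comp (0 : ℝ) (hasDerivAt_line_apply p d 2)

theorem hasDerivAt_extensionVec_line (p d : EuclideanSpace ℝ (Fin 3)) (i : Fin 4) :
    HasDerivAt (fun t : ℝ => extensionVec (p + t • d) i) (extensionDiff p d i) 0 := by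
  fin_cases i
  · exact ((hasDerivAt_line_apply p d 0).add (hasDerivAt_sin_line p d)).div_const 2
  · exact hasDerivAt_line_apply p d 1
  · exact hasDerivAt_y_line p d
  · exact ((hasDerivAt_line_apply p d 0).sub (hasDerivAt_sin_line p d)).div_const 2

theorem hasDerivAt_defining_line (p d : EuclideanSpace ℝ (Fin 3)) :
    HasDerivAt (fun t : ℝ => defining (p + t • d))
      (2 * lorentz (extensionDiff p d) (extensionVec p)) 0 := by
  have h := (((hasDerivAt_line_apply p d 0).neg.mul (hasDerivAt_sin_line p d)).add
    ((hasDerivAt_line_apply p d 1).pow 2)).add ((hasDerivAt_y_line p d).pow 2)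
  refine (h.sub_const 1).congr_deriv ?_
  simp [lorentz, extensionDiff, extensionVec]
  ring

/-- Normalizing to first order projects the differential of `extensionVec` orthogonally to the
position vector, that is, onto the tangent space of de Sitter space. -/
theorem hasDerivAt_ambientExtension_line (j : Fin 3) {p : EuclideanSpace ℝ (Fin 3)}
    (hp : p ∈ surface) (d : EuclideanSpace ℝ (Fin 3)) (i : Fin 3) :
    HasDerivAt (fun t : ℝ => ambientExtension j (p + t • d) i)
      (extensionDiff p d (j.succ.succAbove i) - lorentz (extensionDiff p d) (extensionVec p) *
        extensionVec p (j.succ.succAbove i)) 0 := by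
  have h := (((hasDerivAt_defining_line p d).div_const 2).const_sub 1).mul
    (hasDerivAt_extensionVec_line p d (j.succ.succAbove i))
  refine h.congr_deriv ?_
  simp [defining_eq_zero hp]
  ring

/-- The differential of `extensionVec` is injective and its image does not contain the position
vector. -/
theorem eq_zero_of_extensionDiff_eq {p d : EuclideanSpace ℝ (Fin 3)} {r : ℝ}
    (h : ∀ i, extensionDiff p d i = r * extensionVec p i) : d = 0 := by
  have h0 := h 0
  have h1 := h 1
  have h2 := h 2
  have h3 := h 3
  have hsc := Real.sin_sq_add_cos_sq (2 * p 2)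
  simp [extensionDiff, extensionVec, y] at h0 h1 h2 h3
  generalize Real.sin (2 * p 2) = s at *
  generalize Real.cos (2 * p 2) = c at *
  have hr : r = 0 := by
    -- The plane vectors `(sin 2v, y)` and `(sin 2v, y)'` are independent: up to sign, their
    -- determinant is `sin² 2v + 2 cos² 2v = 1 + cos² 2v`.
    have : r * (1 + c ^ 2) = 0 := by
      linear_combination (-2 * c) * h2 + (2 * p 2 * c - s) * (h0 - h3) - r * hsc
    rcases mul_eq_zero.1 this with h | h
    · exact h
    · nlinarith
  subst hr
  have hd2 : d 2 = 0 := by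
    have e1 : c * d 2 = 0 := by linarith
    have e2 : s * d 2 = 0 := by linear_combination 2 * p 2 * e1 - h2
    linear_combination s * e2 + c * e1 - d 2 * hsc
  ext i
  fin_cases i
  · simp; linarith
  · simpa using h1
  · exact hd2

theorem fderiv_ambientExtension_injective {j : Fin 3} {p : EuclideanSpace ℝ (Fin 3)}
    (hp : p ∈ surface) (hj : extensionVec p j.succ ≠ 0) (d : EuclideanSpace ℝ (Fin 3))
    (hd : fderiv ℝ (ambientExtension j) p d = 0) : d = 0 := by
  have h1 : HasDerivAt (fun t : ℝ => ambientExtension j (p + t • d)) 0 0 := by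
    have h2 : HasDerivAt (fun t : ℝ => p + t • d) d 0 := by
      simpa using ((hasDerivAt_id (0 : ℝ)).smul_const d).const_add p
    have h3 : HasFDerivAt (ambientExtension j) (fderiv ℝ (ambientExtension j) p)
        (p + (0 : ℝ) • d) := by
      rw [zero_smul, add_zero]
      exact ((contDiff_ambientExtension j).differentiable (by simp) p).hasFDerivAt
    rw [← hd]
    exact h3.comp_hasDerivAt (0 : ℝ) h2
  set r := lorentz (extensionDiff p d) (extensionVec p) with hr
  have h2 : ∀ i : Fin 3, extensionDiff p d (j.succ.succAbove i) =
      r * extensionVec p (j.succ.succAbove i) := fun i =>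
    sub_eq_zero.1 ((hasDerivAt_ambientExtension_line j hp d i).unique
      ((EuclideanSpace.proj (𝕜 := ℝ) i).hasFDerivAt.comp_hasDerivAt (0 : ℝ) h1))
  have hmem : lorentz (extensionVec p) (extensionVec p) = 1 := (extension ⟨p, hp⟩).2
  refine eq_zero_of_extensionDiff_eq (p := p) (r := r) fun i => ?_
  refine Fin.succAboveCases j.succ ?_ h2 i
  -- The projected vector is Lorentz-orthogonal to the position vector and all its components but
  -- the deleted one vanish, so only this product survives in the inner product.
  have h3 : (extensionDiff p d j.succ - r * extensionVec p j.succ) * extensionVec p j.succ = 0 := by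
    rw [lorentz] at hr hmem
    clear_value r
    have e0 := h2 0
    have e1 := h2 1
    have e2 := h2 2
    fin_cases j
    · simp [Fin.succAbove, -mul_eq_zero] at e0 e1 e2 ⊢
      linear_combination -hr - r * hmem + e0 * extensionVec p 0 - e1 * extensionVec p 2 -
        e2 * extensionVec p 3
    · simp [Fin.succAbove, -mul_eq_zero] at e0 e1 e2 ⊢
      linear_combination -hr - r * hmem + e0 * extensionVec p 0 - e1 * extensionVec p 1 -
        e2 * extensionVec p 3
    · simp [Fin.succAbove, -mul_eq_zero] at e0 e1 e2 ⊢
      linear_combination -hr - r * hmem + e0 * extensionVec p 0 - e1 * extensionVec p 1 -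
        e2 * extensionVec p 2
  exact sub_eq_zero.1 ((mul_eq_zero.1 h3).resolve_right hj)

/-- The straightening map is the chart of de Sitter space, followed by the local inverse of
`ambientExtension j` and by `toCone k`. -/
theorem isRegularPoint_extension (p : surface) : surfaceDC.IsRegularPoint 3 extension p := by
  obtain ⟨k, hk⟩ := exists_mem_surfaceChart_source p
  obtain ⟨j, ε, hε, hj⟩ := deSitter.exists_chart (extension p)
  obtain ⟨e, hpe, he, hes⟩ := (contDiff_ambientExtension j).exists_openPartialHomeomorph
    (fderiv_ambientExtension_injective p.2 (right_ne_zero_of_mul hj.ne'))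
  have hatlas : deSitter.chart j ε hε ∈ IsManifold.maximalAtlas (𝓡 3) ω deSitter :=
    IsManifold.subset_maximalAtlas ⟨j, ε, hε, rfl⟩
  let s : Set surface := Subtype.val ⁻¹' e.source ∩ extension ⁻¹' (deSitter.chart j ε hε).source
  have hs : IsOpen s := (e.open_source.preimage continuous_subtype_val).inter
    ((deSitter.chart j ε hε).open_source.preimage continuous_extension)
  have hchart : ∀ q : surface, deSitter.chart j ε hε (extension q) = e q := fun q => by
    rw [he, ambientExtension_of_mem j q.2]
    rfl
  refine ⟨(surfaceChart k).restr s, (deSitter.chart j ε hε).trans (e.symm.trans (ambientChart k)),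
    (isCoord_surfaceChart k).restr s, ?_, ?_, ?_, ?_, ?_⟩
  · rw [OpenPartialHomeomorph.restr_source, hs.interior_eq]
    exact ⟨hk, hpe, hj⟩
  · simp only [OpenPartialHomeomorph.trans_source, Set.mem_inter_iff, Set.mem_preimage, hchart,
      OpenPartialHomeomorph.symm_source, e.left_inv hpe]
    exact ⟨hj, e.map_source hpe, hk⟩
  · have h1 : ContDiffOn ℝ ω (e.symm.trans (ambientChart k)) e.target :=
      (contDiff_toCone k).comp_contDiffOn hes
    refine h1.contMDiffOn.comp ((contMDiffOn_of_mem_maximalAtlas hatlas).mono ?_) ?_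
    · intro x hx
      exact hx.1
    · intro x hx
      exact hx.2.1
  · have h1 : ContDiffOn ℝ ω (fun a => e (ofCone k a)) coneSlab :=
      by
      simp only [he]
      exact (contDiff_ambientExtension j).comp_contDiffOn (contDiffOn_ofCone k)
    refine (contMDiffOn_symm_of_mem_maximalAtlas hatlas).comp (h1.contMDiffOn.mono ?_) ?_
    · intro x hx
      exact hx.1.1
    · intro x hx
      exact hx.2
  · intro q hq
    rw [OpenPartialHomeomorph.restr_source, hs.interior_eq] at hq
    obtain ⟨hqk, hqe, hqj⟩ := hq
    refine ⟨?_, ?_⟩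
    · simp only [OpenPartialHomeomorph.trans_source, Set.mem_inter_iff, Set.mem_preimage, hchart,
        OpenPartialHomeomorph.symm_source, e.left_inv hqe]
      exact ⟨hqj, e.map_source hqe, hqk⟩
    · rw [zeroPad_self]
      change ambientChart k (e.symm (deSitter.chart j ε hε (extension q))) = _
      rw [hchart, e.left_inv hqe]
      rfl

/-! ### Connectedness, and density of the points with `sin 2v ≠ 0` -/

theorem connectedSpace_surface : ConnectedSpace surface := by
  rw [connectedSpace_iff_univ]
  have h : IsConnected (⋃ k : ℤ, (surfaceChart k).source) := by
    refine IsConnected.iUnion_of_chain (fun k => ?_) fun k => ?_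
    · rw [← OpenPartialHomeomorph.symm_image_target_eq_source]
      exact (isConnected_surfaceChart_target k).image _ (surfaceChart k).continuousOn_symm
    · have hp := Real.pi_pos
      -- A point halfway between consecutive centers lies in both charts.
      refine ⟨param (0, center k + Real.pi / 4), ?_, ?_⟩
      · change |center k + Real.pi / 4 - center k| < _
        rw [add_sub_cancel_left, abs_of_pos] <;> linarith
      · change |center k + Real.pi / 4 - center (k + 1)| < _
        rw [show center k + Real.pi / 4 - center (k + 1) = -(Real.pi / 4) by
          simp only [center]; push_cast; ring, abs_neg, abs_of_pos] <;> linarith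
  convert h
  exact (Set.iUnion_eq_univ_iff.2 exists_mem_surfaceChart_source).symm

/-- In the section `a₂ + a₀ = b` of the cone, with `s = a₂ - a₀` and `x = a₁`, this is a curve
leaving the line `s = 0`: a parabola if `b ≠ 0`, a generator through the vertex if `b = 0`. -/
theorem exists_curve_of_cone (b : ℝ) : ∃ x s : ℝ → ℝ, Continuous x ∧ Continuous s ∧ x 0 = 0 ∧
    s 0 = 0 ∧ (∀ t, t ≠ 0 → s t ≠ 0) ∧ ∀ t, x t ^ 2 = s t * b := by
  by_cases hb : b = 0
  · exact ⟨fun _ => 0, fun t => t, continuous_const, continuous_id, rfl, rfl, fun t ht => ht,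
      fun t => by simp [hb]⟩
  · exact ⟨fun t => t, fun t => t ^ 2 / b, continuous_id, by fun_prop, rfl, by simp,
      fun t ht => by positivity, fun t => by field_simp⟩

/-- In a cone chart the exceptional points form the generator `a₂ = a₀`, and each of them is a limit
along a curve of the preceding lemma. -/
theorem dense_sin_ne_zero :
    Dense {p : surface | Real.sin (2 * (p : EuclideanSpace ℝ (Fin 3)) 2) ≠ 0} := by
  intro p
  by_cases hs : Real.sin (2 * (p : EuclideanSpace ℝ (Fin 3)) 2) = 0
  swap
  · exact subset_closure hs
  obtain ⟨k, hk⟩ := exists_mem_surfaceChart_source p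
  have hp := mem_surface_iff.1 p.2
  rw [hs, zero_mul] at hp
  have hp1 : (p : EuclideanSpace ℝ (Fin 3)) 1 = 0 := by simpa using hp
  have hv : (p : EuclideanSpace ℝ (Fin 3)) 2 - center k = 0 := by
    rw [← ratio_mul k] at hs
    exact (mul_eq_zero.1 hs).resolve_left (ratio_ne_zero hk)
  set b : ℝ := toCone k p 2 + toCone k p 0 with hb
  obtain ⟨x, s, hx, hsc, hx0, hs0, hsne, hxs⟩ := exists_curve_of_cone b
  let a : ℝ → doubleCone 2 := fun t => ⟨!₂[(b - s t) / 2, x t, (b + s t) / 2], by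
    rw [mem_doubleCone_two_iff]
    simp [hxs]
    ring⟩
  have ha : Continuous a := by
    refine ((PiLp.continuous_toLp 2 _).comp (continuous_pi fun i => ?_)).subtype_mk _
    fin_cases i
    · exact (continuous_const.sub hsc).div_const 2
    · exact hx
    · exact (continuous_const.add hsc).div_const 2
  have ha0 : a 0 = surfaceChart k p := by
    have h1 := toCone_sub k (p : EuclideanSpace ℝ (Fin 3))
    rw [hv] at h1
    refine Subtype.ext ?_
    rw [surfaceChart_apply]
    ext i
    fin_cases i
    · simp [a, hs0]; linarith
    · simp [a, hx0, toCone, hp1]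
    · simp [a, hs0]; linarith
  have htend : Filter.Tendsto (fun t => (surfaceChart k).symm (a t)) (𝓝[≠] 0) (𝓝 p) := by
    have h1 : ContinuousAt (surfaceChart k).symm (a 0) := by
      rw [ha0]
      exact (surfaceChart k).continuousAt_symm ((surfaceChart k).map_source hk)
    have h2 : ContinuousAt (fun t => (surfaceChart k).symm (a t)) 0 :=
      ContinuousAt.comp (g := (surfaceChart k).symm) h1 ha.continuousAt
    have h3 := h2.tendsto
    rw [ha0, (surfaceChart k).left_inv hk] at h3
    exact h3.mono_left nhdsWithin_le_nhds
  refine mem_closure_of_tendsto htend ?_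
  have hev : ∀ᶠ t in 𝓝 0, a t ∈ (surfaceChart k).target := by
    refine ha.continuousAt.eventually_mem ((surfaceChart k).open_target.mem_nhds ?_)
    rw [ha0]
    exact (surfaceChart k).map_source hk
  filter_upwards [nhdsWithin_le_nhds hev, self_mem_nhdsWithin] with t ht ht0
  have hst : (a t : EuclideanSpace ℝ (Fin 3)) 2 - (a t : EuclideanSpace ℝ (Fin 3)) 0 = s t := by
    simp [a]
    ring
  have h2 : ((surfaceChart k).symm (a t) : EuclideanSpace ℝ (Fin 3)) 2 = s t + center k := by
    rw [surfaceChart_symm_apply k ht, ← hst]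
    rfl
  change Real.sin _ ≠ 0
  have h3 : |s t| < Real.pi / 2 := by
    rw [← hst]
    exact ht
  rw [h2, ← ratio_mul k, add_sub_cancel_right]
  refine mul_ne_zero (ratio_ne_zero ?_) (hsne t ht0)
  rwa [add_sub_cancel_right]

theorem isSpacelikeCMCOneDCImmersion_extension :
    surfaceDC.IsSpacelikeCMCOneDCImmersion extension := by
  refine ⟨connectedSpace_surface, ⟨by norm_num, isAnalytic_extension, isRegularPoint_extension⟩,
    _, ?_, isSpacelikeCMCOneOn_extension⟩
  convert dense_sin_ne_zero using 1
  ext p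
  rw [Set.mem_compl_iff, Set.mem_preimage, extension_mem_lines_iff]
  rfl

end LH

/-! ### Convergence of `v` from convergence of `sin 2v` -/

/-- A continuous real function `v` on `[s, t)` converges at `t` if `sin 2v` does. -/
theorem exists_tendsto_of_tendsto_sin_two_mul {v : ℝ → ℝ} {s t b : ℝ} (hst : s < t)
    (hv : ContinuousOn v (Set.Ico s t))
    (hb : Filter.Tendsto (fun τ => Real.sin (2 * v τ)) (𝓝[<] t) (𝓝 b)) :
    ∃ c, Filter.Tendsto v (𝓝[<] t) (𝓝 c) := by
  have hIco : ∀ {a}, a < t → Set.Ioo a t ∈ 𝓝[<] t := fun h => Ioo_mem_nhdsLT h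
  have hivt : ∀ {p q}, p ∈ Set.Ico s t → q ∈ Set.Ico s t → ∀ w ∈ Set.uIcc (v p) (v q),
      ∃ r ∈ Set.uIcc p q, v r = w := by
    intro p q hp hq w hw
    have hsub : Set.uIcc p q ⊆ Set.Ico s t := Set.ordConnected_Ico.uIcc_subset hp hq
    exact intermediate_value_uIcc (hv.mono hsub) hw
  have hbd : ∃ M, ∀ᶠ τ in 𝓝[<] t, |v τ| ≤ M := by
    have h1 : ∀ᶠ τ in 𝓝[<] t, |Real.sin (2 * v τ) - b| < 1 :=
      (Metric.tendsto_nhds.1 hb 1 one_pos).mono fun τ h => h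
    obtain ⟨a, hat, ha⟩ := (mem_nhdsLT_iff_exists_Ioo_subset' hst).1 h1
    obtain ⟨T, hT1, hT2⟩ := exists_between (max_lt hat hst)
    have haT : a < T := (le_max_left _ _).trans_lt hT1
    have hsT : s < T := (le_max_right _ _).trans_lt hT1
    -- As `π < 4`, exceeding this bound makes `v` sweep a full period of `sin 2v` after time `T`.
    -- Then `sin 2v` takes both values `1` and `-1`, which cannot both be at distance less than `1`
    -- from `b`.
    refine ⟨|v T| + 4, ?_⟩
    filter_upwards [hIco hT2] with τ hτ
    by_contra! hcon
    have hlong : 4 < |v τ - v T| := by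
      have := abs_sub_abs_le_abs_sub (v τ) (v T)
      linarith
    have hpi := Real.pi_lt_four
    have hval : ∀ z : ℝ, ∃ r, T ≤ r ∧ r < t ∧ Real.sin (2 * v r) = Real.sin z := by
      intro z
      obtain ⟨k, hk, -⟩ := existsUnique_add_zsmul_mem_Ico Real.pi_pos (z / 2)
        (min (v T) (v τ))
      obtain ⟨r, hr, hrv⟩ := hivt (p := T) (q := τ) ⟨hsT.le, hT2⟩
        ⟨(hsT.trans hτ.1).le, hτ.2⟩ (z / 2 + k • Real.pi) (by
          rw [Set.mem_uIcc]
          rcases le_total (v T) (v τ) with h | h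
          · rw [min_eq_left h] at hk
            rw [abs_of_nonneg (by linarith)] at hlong
            exact Or.inl ⟨hk.1, by linarith [hk.2]⟩
          · rw [min_eq_right h] at hk
            rw [abs_of_nonpos (by linarith)] at hlong
            exact Or.inr ⟨hk.1, by linarith [hk.2]⟩)
      rw [Set.uIcc_of_le hτ.1.le] at hr
      refine ⟨r, hr.1, hr.2.trans_lt hτ.2, ?_⟩
      rw [hrv, zsmul_eq_mul, show 2 * (z / 2 + k * Real.pi) = z + k * (2 * Real.pi) by ring,
        Real.sin_add_int_mul_two_pi]
    obtain ⟨r, hr1, hr2, hr⟩ := hval (Real.pi / 2)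
    obtain ⟨r', hr1', hr2', hr'⟩ := hval (-(Real.pi / 2))
    have e1 := ha ⟨haT.trans_le hr1, hr2⟩
    have e2 := ha ⟨haT.trans_le hr1', hr2'⟩
    change |Real.sin (2 * v r) - b| < 1 at e1
    change |Real.sin (2 * v r') - b| < 1 at e2
    rw [hr, Real.sin_pi_div_two, abs_lt] at e1
    rw [hr', Real.sin_neg, Real.sin_pi_div_two, abs_lt] at e2
    linarith [e1.1, e1.2, e2.1, e2.2]
  obtain ⟨M, hM⟩ := hbd
  -- If `v` oscillated across `(p, q)`, the intermediate value theorem would make it take every `w`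
  -- in between arbitrarily close to `t`. Then `sin 2w = b` on an interval, so `cos 2w` and, after
  -- another derivative, `sin 2w` would vanish there.
  refine tendsto_of_no_upcrossings dense_univ ?_ ?_ ?_
  · rintro p - q - hpq ⟨hp, hq⟩
    have hfreq : ∀ w ∈ Set.Ioo p q, Real.sin (2 * w) = b := by
      intro w hw
      have hw' : ∃ᶠ τ in 𝓝[<] t, v τ = w := by
        rw [Filter.frequently_iff]
        intro U hU
        obtain ⟨a, hat, ha⟩ := (mem_nhdsLT_iff_exists_Ioo_subset' hst).1 hU
        have hm : Set.Ioo (max a s) t ∈ 𝓝[<] t := hIco (max_lt hat hst)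
        obtain ⟨τ, hτp, hτ⟩ := (hp.and_eventually hm).exists
        obtain ⟨τ', hτq, hτ'⟩ := (hq.and_eventually hm).exists
        obtain ⟨r, hr, hrw⟩ := hivt (p := τ) (q := τ')
          ⟨((le_max_right _ _).trans_lt hτ.1).le, hτ.2⟩
          ⟨((le_max_right _ _).trans_lt hτ'.1).le, hτ'.2⟩ w
          (Set.mem_uIcc_of_le (hτp.trans hw.1).le (hw.2.trans hτq).le)
        have hr' := Set.ordConnected_Ioo.uIcc_subset hτ hτ' hr
        exact ⟨r, ha ⟨(le_max_left _ _).trans_lt hr'.1, hr'.2⟩, hrw⟩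
      by_contra hne
      have h1 := hb.eventually_ne (Ne.symm hne)
      obtain ⟨τ, hτ, hτ'⟩ := (hw'.and_eventually h1).exists
      exact hτ' (by rw [hτ])
    obtain ⟨w, hw⟩ := exists_between hpq
    have hnhds : ∀ z ∈ Set.Ioo p q, Real.cos (2 * z) = 0 := by
      intro z hz
      have h1 : HasDerivAt (fun x : ℝ => Real.sin (2 * x)) (Real.cos (2 * z) * (2 * 1)) z :=
        ((hasDerivAt_id z).const_mul 2).sin
      have h2 := h1.unique ((hasDerivAt_const z b).congr_of_eventuallyEq
        (Filter.mem_of_superset (isOpen_Ioo.mem_nhds hz) hfreq))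
      linarith
    have h1 : HasDerivAt (fun x : ℝ => Real.cos (2 * x)) (-Real.sin (2 * w) * (2 * 1)) w :=
      ((hasDerivAt_id w).const_mul 2).cos
    have h2 := h1.unique ((hasDerivAt_const w 0).congr_of_eventuallyEq
      (Filter.mem_of_superset (isOpen_Ioo.mem_nhds hw) hnhds))
    have h3 := Real.sin_sq_add_cos_sq (2 * w)
    rw [hnhds w hw, show Real.sin (2 * w) = 0 by linarith] at h3
    norm_num at h3
  · exact ⟨M, Filter.eventually_map.2 (hM.mono fun τ h => (abs_le.1 h).2)⟩
  · exact ⟨-M, Filter.eventually_map.2 (hM.mono fun τ h => (abs_le.1 h).1)⟩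

/-! ### Analytic extension, non-properness and arc-properness -/

namespace LH

theorem isAnalytic_catenoid : planeDC.IsAnalytic 3 catenoid := by
  rintro _ rfl _ ⟨j, ε, hε, rfl⟩
  have hopen : IsOpen {a : EuclideanSpace ℝ (Fin 3) | 0 < a 2 - a 0} :=
    isOpen_lt continuous_const (by fun_prop)
  have hinv : ContDiffOn ℝ ω (fun a : EuclideanSpace ℝ (Fin 3) => (Real.log (a 2 - a 0), a 1))
      {a | 0 < a 2 - a 0} :=
    ContDiffOn.prodMk (ContDiffOn.log (by fun_prop) fun a ha => ne_of_gt ha) (by fun_prop)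
  have hcat : Continuous catenoid := by
    refine Topology.IsInducing.subtypeVal.continuous_iff.2 ?_
    exact contDiff_catenoidVec.continuous.congr fun w => (coe_catenoid w).symm
  refine .of_contDiffOn hopen ((deSitter.contDiff_drop j).comp_contDiffOn
    (contDiff_catenoidVec.comp_contDiffOn hinv))
    (planeChart.continuousOn_symm.isOpen_inter_preimage planeChart.open_target
      ((deSitter.chart j ε hε).open_source.preimage hcat)) (fun a ha => ha.1) fun a ha => ?_
  change _ = deSitter.drop j (catenoid _ : EuclideanSpace ℝ (Fin 4))
  rw [coe_catenoid]
  rfl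

theorem isAnalyticMap_param : planeDC.IsAnalyticMap surfaceDC param := by
  rintro _ rfl _ ⟨k, rfl⟩
  have hopen : IsOpen {a : EuclideanSpace ℝ (Fin 3) | 0 < a 2 - a 0} :=
    isOpen_lt continuous_const (by fun_prop)
  have hinv : ContDiffOn ℝ ω (fun a : EuclideanSpace ℝ (Fin 3) => (Real.log (a 2 - a 0), a 1))
      {a | 0 < a 2 - a 0} :=
    ContDiffOn.prodMk (ContDiffOn.log (by fun_prop) fun a ha => ne_of_gt ha) (by fun_prop)
  have hparam : Continuous param := contDiff_paramVec.continuous.subtype_mk paramVec_mem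
  exact .of_contDiffOn hopen ((contDiff_toCone k).comp_contDiffOn
    (contDiff_paramVec.comp_contDiffOn hinv))
    (planeChart.continuousOn_symm.isOpen_inter_preimage planeChart.open_target
      ((surfaceChart k).open_source.preimage hparam)) (fun a ha => ha.1) fun a ha => rfl

theorem y_zero : y 0 = 1 := by simp [y]

theorem line_one_subset : line 1 ⊆ Set.range extension := by
  rintro X ⟨t, ht⟩
  refine ⟨⟨!₂[2 * t, 0, 0], by simp [mem_surface_iff]⟩, Subtype.ext ?_⟩
  rw [ht, coe_extension]
  ext i
  fin_cases i <;> simp [extensionVec, y_zero]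

theorem line_neg_one_subset : line (-1) ⊆ Set.range extension := by
  rintro X ⟨t, ht⟩
  have h : 2 * (Real.pi / 2) = Real.pi := by ring
  refine ⟨⟨!₂[2 * t, 0, Real.pi / 2], by simp [mem_surface_iff, h]⟩, Subtype.ext ?_⟩
  rw [ht, coe_extension]
  ext i
  fin_cases i <;> simp [extensionVec, h, y]

theorem range_catenoid_subset : Set.range catenoid ⊆ Set.range extension := by
  rintro _ ⟨w, rfl⟩
  exact ⟨param w, extension_param w⟩

theorem range_extension :
    Set.range extension = Set.range catenoid ∪ line 1 ∪ line (-1) := by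
  refine Set.Subset.antisymm ?_ (Set.union_subset (Set.union_subset range_catenoid_subset
    line_one_subset) line_neg_one_subset)
  rintro _ ⟨p, rfl⟩
  rw [Set.union_assoc]
  by_cases h : Real.sin (2 * (p : EuclideanSpace ℝ (Fin 3)) 2) = 0
  · exact Or.inr (extension_mem_lines_iff.2 h)
  · exact Or.inl ⟨(_, _), (extension_param _).symm.trans (congrArg extension (param_eq h))⟩

theorem isAnalyticExtension :
    DCStructure.IsAnalyticExtension 3 planeDC surfaceDC catenoid extension := by
  refine ⟨isAnalytic_catenoid, isAnalytic_extension, ⟨param, isAnalyticMap_param, ?_⟩,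
    range_catenoid_subset, ?_⟩
  · funext w
    exact (extension_param w).symm
  · intro hsub
    -- The catenoid meets this line only where `sin 2v = 0` and `cos 2v = 1`, and there its outer
    -- coordinates equal `v`. This point would need `v = 1`, but `sin 2 ≠ 0`.
    have hmem : (⟨!₂[1, 0, 1, 1], by simp [deSitter, lorentz]⟩ : deSitter) ∈ line 1 := ⟨1, rfl⟩
    obtain ⟨w, hw⟩ := hsub (line_one_subset hmem)
    have hw' := congrArg Subtype.val hw
    rw [coe_catenoid] at hw'
    have h0 := congrArg (fun x : EuclideanSpace ℝ (Fin 4) => x 0) hw'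
    have h2 := congrArg (fun x : EuclideanSpace ℝ (Fin 4) => x 2) hw'
    have h3 := congrArg (fun x : EuclideanSpace ℝ (Fin 4) => x 3) hw'
    simp [catenoidVec] at h0 h2 h3
    have hs : Real.sin (2 * w.2) = 0 := by linear_combination h0 - h3
    rw [hs] at h0 h2
    have hw1 : w.2 = 1 := by
      rw [show Real.cos (2 * w.2) = 1 by linarith] at h0
      linarith
    rw [hw1] at hs
    have := Real.sin_pos_of_pos_of_lt_pi (x := 2 * 1) (by norm_num) (by linarith [Real.pi_gt_three])
    linarith

/-- The fibre over `(0, 0, 1, 0)` contains all points `(0, 0, kπ)` with `k` a natural number, so it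
is not compact. -/
theorem not_isProperMap_extension : ¬ IsProperMap extension := by
  intro h
  let X : deSitter := ⟨!₂[0, 0, 1, 0], by simp [deSitter, lorentz]⟩
  have hc : IsCompact (extension ⁻¹' {X}) := h.isCompact_preimage isCompact_singleton
  have hc2 : IsCompact ((fun p : surface => (p : EuclideanSpace ℝ (Fin 3)) 2) ''
      (extension ⁻¹' {X})) := hc.image (by fun_prop)
  obtain ⟨B, hB⟩ := hc2.bddAbove
  obtain ⟨k, hk⟩ := exists_nat_gt B
  have hs : Real.sin (2 * (k * Real.pi)) = 0 := by
    rw [show 2 * (k * Real.pi) = ((2 * k : ℕ) : ℝ) * Real.pi by push_cast; ring,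
      Real.sin_nat_mul_pi]
  have hcs : Real.cos (2 * (k * Real.pi)) = 1 := by
    rw [show 2 * (k * Real.pi) = k * (2 * Real.pi) by ring, Real.cos_nat_mul_two_pi]
  have hmem : (!₂[0, 0, k * Real.pi] : EuclideanSpace ℝ (Fin 3)) ∈ surface := by
    simp [mem_surface_iff, hs]
  have h1 : (k : ℝ) * Real.pi ≤ B := by
    refine hB ⟨⟨_, hmem⟩, Subtype.ext ?_, rfl⟩
    rw [coe_extension]
    ext i
    fin_cases i <;> simp [extensionVec, hs, hcs, X, y]
  nlinarith [Real.pi_gt_three, (Nat.cast_nonneg k : (0 : ℝ) ≤ k)]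

/-- The limits of `ξ`, `x` and `sin 2v` are read off from the arc, continuity of `v` gives its
limit, and the surface is closed. So the lift converges, not only along a sequence. -/
theorem isArcProper_extension : IsArcProper 3 0 extension := by
  refine ⟨continuous_extension, ?_⟩
  rintro σ hσ ⟨Γ, hΓ, hΓσ⟩
  have hΓc : ContinuousWithinAt Γ (Set.Icc 0 1) 1 := hΓ.continuousOn 1 (by simp)
  have hΓt : Filter.Tendsto (fun t => (Γ t : EuclideanSpace ℝ (Fin 4))) (𝓝[<] 1) (𝓝 (Γ 1)) := by
    refine (continuous_subtype_val.tendsto _).comp (hΓc.tendsto.mono_left ?_)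
    rw [← nhdsWithin_Ioo_eq_nhdsLT (zero_lt_one' ℝ)]
    exact nhdsWithin_mono _ Set.Ioo_subset_Icc_self
  have hcoord : ∀ i, Filter.Tendsto (fun t => (Γ t : EuclideanSpace ℝ (Fin 4)) i) (𝓝[<] 1)
      (𝓝 ((Γ 1 : EuclideanSpace ℝ (Fin 4)) i)) := fun i =>
    (((EuclideanSpace.proj (𝕜 := ℝ) i).continuous.tendsto _).comp hΓt :)
  -- Transfers `σ` to the real line; the default value outside `[0, 1)` plays no role for limits
  -- from the left at `1`.
  let c : ℝ → Set.Ico (0 : ℝ) 1 := fun t =>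
    if h : t ∈ Set.Ico (0 : ℝ) 1 then ⟨t, h⟩ else ⟨0, by simp⟩
  have hc : ∀ t (h : t ∈ Set.Ico (0 : ℝ) 1), c t = ⟨t, h⟩ := fun t h => dif_pos h
  have hcc : ContinuousOn c (Set.Ico 0 1) := by
    refine Topology.IsInducing.subtypeVal.continuousOn_iff.2 ?_
    refine continuousOn_id.congr fun t ht => ?_
    simp only [Function.comp, hc t ht, id]
  have hext : ∀ t ∈ Set.Ico (0 : ℝ) 1, ∀ i,
      (Γ t : EuclideanSpace ℝ (Fin 4)) i = extensionVec (σ (c t)) i := by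
    intro t ht i
    rw [← coe_extension, hc t ht]
    exact congrArg (fun X : deSitter => (X : EuclideanSpace ℝ (Fin 4)) i) (hΓσ ⟨t, ht⟩)
  have hIco : Set.Ico (0 : ℝ) 1 ∈ 𝓝[<] (1 : ℝ) := Ico_mem_nhdsLT zero_lt_one
  have hv : ContinuousOn (fun t => (σ (c t) : EuclideanSpace ℝ (Fin 3)) 2) (Set.Ico 0 1) :=
    (show Continuous fun τ => (σ τ : EuclideanSpace ℝ (Fin 3)) 2 by fun_prop).comp_continuousOn hcc
  have h0 : Filter.Tendsto (fun t => (σ (c t) : EuclideanSpace ℝ (Fin 3)) 0) (𝓝[<] 1)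
      (𝓝 ((Γ 1 : EuclideanSpace ℝ (Fin 4)) 0 + (Γ 1 : EuclideanSpace ℝ (Fin 4)) 3)) := by
    refine ((hcoord 0).add (hcoord 3)).congr' ?_
    filter_upwards [hIco] with t ht
    rw [hext t ht, hext t ht]
    simp [extensionVec]
    ring
  have h1 : Filter.Tendsto (fun t => (σ (c t) : EuclideanSpace ℝ (Fin 3)) 1) (𝓝[<] 1)
      (𝓝 ((Γ 1 : EuclideanSpace ℝ (Fin 4)) 1)) := by
    refine (hcoord 1).congr' ?_
    filter_upwards [hIco] with t ht
    rw [hext t ht]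
    simp [extensionVec]
  have hs : Filter.Tendsto (fun t => Real.sin (2 * (σ (c t) : EuclideanSpace ℝ (Fin 3)) 2)) (𝓝[<] 1)
      (𝓝 ((Γ 1 : EuclideanSpace ℝ (Fin 4)) 0 - (Γ 1 : EuclideanSpace ℝ (Fin 4)) 3)) := by
    refine ((hcoord 0).sub (hcoord 3)).congr' ?_
    filter_upwards [hIco] with t ht
    rw [hext t ht, hext t ht]
    simp [extensionVec]
    ring
  obtain ⟨v₀, h2⟩ := exists_tendsto_of_tendsto_sin_two_mul zero_lt_one hv hs
  set x : EuclideanSpace ℝ (Fin 3) := !₂[(Γ 1 : EuclideanSpace ℝ (Fin 4)) 0 +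
    (Γ 1 : EuclideanSpace ℝ (Fin 4)) 3, (Γ 1 : EuclideanSpace ℝ (Fin 4)) 1, v₀] with hx
  have hlim : Filter.Tendsto (fun t => (σ (c t) : EuclideanSpace ℝ (Fin 3))) (𝓝[<] 1) (𝓝 x) := by
    have hpi : Filter.Tendsto (fun t => WithLp.ofLp (σ (c t) : EuclideanSpace ℝ (Fin 3)))
        (𝓝[<] 1) (𝓝 (WithLp.ofLp x)) := by
      rw [tendsto_pi_nhds]
      intro i
      fin_cases i
      · exact h0
      · exact h1
      · exact h2
    exact ((PiLp.continuous_toLp 2 _).tendsto _).comp hpi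
  have hxs : x ∈ surface := isClosed_surface.mem_of_tendsto hlim
    (Filter.Eventually.of_forall fun t => (σ (c t)).2)
  have hτ : Filter.Tendsto (fun n : ℕ => 1 - 1 / ((n : ℝ) + 1)) Filter.atTop (𝓝[<] 1) := by
    refine tendsto_nhdsWithin_iff.2 ⟨?_, Filter.Eventually.of_forall fun n => ?_⟩
    · simpa using (tendsto_one_div_add_atTop_nhds_zero_nat (𝕜 := ℝ)).const_sub 1
    · have : (0 : ℝ) < 1 / ((n : ℝ) + 1) := by positivity
      simp only [Set.mem_Iio]
      linarith
  refine ⟨fun n => c (1 - 1 / ((n : ℝ) + 1)), ?_, ⟨x, hxs⟩, ?_⟩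
  · refine (hτ.mono_right nhdsWithin_le_nhds).congr' ?_
    filter_upwards [hτ.eventually hIco] with n hn
    rw [hc _ hn]
  · exact tendsto_subtype_rng.2 (hlim.comp hτ)

end LH

/-! ### Lifting analytic arcs to an immersed curve -/

/-- Lifts to a locally injective curve with the same starting point agree. -/
theorem lift_unique {E : Type*} [TopologicalSpace E] {C : ℝ → E} (hC : IsLocallyInjective C) {γ : ℝ → E} {u u' : ℝ → ℝ}
    {s t t' : ℝ} (hu : ContinuousOn u (Set.Ico s t)) (hu' : ContinuousOn u' (Set.Ico s t'))
    (hγ : ∀ τ ∈ Set.Ico s t, C (u τ) = γ τ) (hγ' : ∀ τ ∈ Set.Ico s t', C (u' τ) = γ τ)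
    (h0 : u s = u' s) {τ : ℝ} (hsτ : s ≤ τ) (hτ : τ < t) (hτ' : τ < t') : u τ = u' τ := by
  have h1 : Set.Icc s τ ⊆ Set.Ico s t := fun x hx => ⟨hx.1, hx.2.trans_lt hτ⟩
  have h2 : Set.Icc s τ ⊆ Set.Ico s t' := fun x hx => ⟨hx.1, hx.2.trans_lt hτ'⟩
  exact (T2Space.isSeparatedMap C).eqOn_of_comp_eqOn hC isPreconnected_Icc (hu.mono h1)
    (hu'.mono h2) (fun x hx => (hγ x (h1 hx)).trans (hγ' x (h2 hx)).symm)
    (Set.left_mem_Icc.2 hsτ) h0 (Set.right_mem_Icc.2 hsτ)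

section Lifting

variable {E : Type*} [NormedAddCommGroup E] [NormedSpace ℝ E]

theorem isLocallyInjective_of_local_leftInverse {C : ℝ → E}
    (hinv : ∀ v₀, ∃ g : E → ℝ, AnalyticAt ℝ g (C v₀) ∧ ∀ᶠ v in 𝓝 v₀, g (C v) = v) :
    IsLocallyInjective C := by
  rw [isLocallyInjective_iff_nhds]
  intro v₀
  obtain ⟨g, -, hg⟩ := hinv v₀
  exact ⟨_, hg, Set.LeftInvOn.injOn fun v hv => hv⟩

/-- A continuous curve with values in the image of a locally invertible curve `C` has a continuous
lift on some interval. -/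
theorem exists_local_lift {C : ℝ → E} (hC : Continuous C)
    (hinv : ∀ v₀, ∃ g : E → ℝ, AnalyticAt ℝ g (C v₀) ∧ ∀ᶠ v in 𝓝 v₀, g (C v) = v)
    {γ : ℝ → E} {ε : ℝ} (hε : 0 < ε) (hγ : ContinuousOn γ (Set.Ioo 0 ε))
    (hmem : ∀ t ∈ Set.Ioo 0 ε, γ t ∈ Set.range C) :
    ∃ s t, 0 < s ∧ s < t ∧ t ≤ ε ∧ ∃ v : ℝ → ℝ, ContinuousOn v (Set.Ico s t) ∧
      ∀ τ ∈ Set.Ico s t, C (v τ) = γ τ := by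
  have hloc : ∀ v₀, ∃ g : E → ℝ, ∃ K ∈ 𝓝 v₀, IsCompact K ∧
      ∀ v ∈ K, ContinuousAt g (C v) ∧ g (C v) = v := by
    intro v₀
    obtain ⟨g, hg, hgC⟩ := hinv v₀
    have h1 : ∀ᶠ v in 𝓝 v₀, AnalyticAt ℝ g (C v) :=
      hC.continuousAt.eventually hg.eventually_analyticAt
    obtain ⟨K, hK, hKs, hKc⟩ := local_compact_nhds (h1.and hgC)
    exact ⟨g, K, hK, hKc, fun v hv => ⟨(hKs hv).1.continuousAt, (hKs hv).2⟩⟩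
  choose g K hK hKc hg using hloc
  obtain ⟨S, hS, hSK⟩ := TopologicalSpace.countable_cover_nhds hK
  have : Countable S := hS.to_subtype
  have : Nonempty (Set.Ioo 0 ε) := ⟨⟨ε / 2, by constructor <;> linarith⟩⟩
  have : LocallyCompactSpace (Set.Ioo 0 ε) := isOpen_Ioo.locallyCompactSpace
  -- Countably many closed sets `{t | γ t ∈ C '' K i}` cover the interval, so by Baire one of them
  -- has interior. There `γ` stays in a single compact branch of `C`, and `g i ∘ γ` is a lift.
  have hγr : Continuous fun t : Set.Ioo 0 ε => γ t := continuousOn_iff_continuous_domRestrict.1 hγ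
  obtain ⟨i, ⟨t₀, ht₀⟩⟩ := nonempty_interior_of_iUnion_of_closed
    (f := fun i : S => {t : Set.Ioo 0 ε | γ t ∈ C '' K i})
    (fun i => ((hKc i).image hC).isClosed.preimage hγr) (by
      refine Set.eq_univ_of_forall fun t => ?_
      obtain ⟨v, hv⟩ := hmem t t.2
      obtain ⟨i, hi, hvi⟩ := Set.mem_iUnion₂.1 (hSK.ge (Set.mem_univ v))
      exact Set.mem_iUnion.2 ⟨⟨i, hi⟩, v, hvi, hv⟩)
  have hopen : IsOpen (Subtype.val '' interior {t : Set.Ioo 0 ε | γ t ∈ C '' K i}) :=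
    isOpen_Ioo.isOpenMap_subtype_val _ isOpen_interior
  obtain ⟨a, b, hab, hsub⟩ := mem_nhds_iff_exists_Ioo_subset.1 (hopen.mem_nhds ⟨t₀, ht₀, rfl⟩)
  have hsub' : ∀ t ∈ Set.Ioo a b, t ∈ Set.Ioo 0 ε ∧ γ t ∈ C '' K i := by
    intro t ht
    obtain ⟨t', ht', rfl⟩ := hsub ht
    exact ⟨t'.2, (interior_subset ht' : t' ∈ {t : Set.Ioo 0 ε | γ t ∈ C '' K i})⟩
  obtain ⟨t, ht1, ht2⟩ := exists_between hab.2
  have hIco : Set.Ico (t₀ : ℝ) t ⊆ Set.Ioo a b := fun x hx =>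
    ⟨hab.1.trans_le hx.1, hx.2.trans ht2⟩
  refine ⟨t₀, t, t₀.2.1, ht1, (hsub' t ⟨hab.1.trans ht1, ht2⟩).1.2.le, g i ∘ γ, ?_, ?_⟩
  · intro τ hτ
    obtain ⟨hτε, w, hw, hwτ⟩ := hsub' τ (hIco hτ)
    have h1 : ContinuousAt (g i) (γ τ) := hwτ ▸ (hg i w hw).1
    exact (h1.comp (hγ.continuousAt (isOpen_Ioo.mem_nhds hτε))).continuousWithinAt
  · intro τ hτ
    obtain ⟨-, w, hw, hwτ⟩ := hsub' τ (hIco hτ)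
    rw [Function.comp, ← hwτ, (hg i w hw).2]

/-- A continuous lift on `[s, T)` of an analytic curve extends beyond `T`. -/
theorem exists_lift_extension {C : ℝ → E} (hC : ∀ v, AnalyticAt ℝ C v)
    (hinv : ∀ v₀, ∃ g : E → ℝ, AnalyticAt ℝ g (C v₀) ∧ ∀ᶠ v in 𝓝 v₀, g (C v) = v)
    {γ : ℝ → E} {s T r : ℝ} (hsT : s < T) (hTr : T < r) (hγ : AnalyticAt ℝ γ T) {v : ℝ → ℝ}
    (hv : ContinuousOn v (Set.Ico s T)) (hvγ : ∀ τ ∈ Set.Ico s T, C (v τ) = γ τ) {c : ℝ}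
    (hc : Filter.Tendsto v (𝓝[<] T) (𝓝 c)) (hcT : C c = γ T) :
    ∃ b, T < b ∧ b ≤ r ∧ ∃ w : ℝ → ℝ, ContinuousOn w (Set.Ico s b) ∧ w s = v s ∧
      ∀ τ ∈ Set.Ico s b, C (w τ) = γ τ := by
  obtain ⟨g, hg, hgC⟩ := hinv c
  have hIco : Set.Ico s T ∈ 𝓝[<] T := Ico_mem_nhdsLT hsT
  rw [hcT] at hg
  have hh : AnalyticAt ℝ (g ∘ γ) T := hg.comp hγ
  have hhv : ∀ᶠ τ in 𝓝[<] T, g (γ τ) = v τ := by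
    filter_upwards [hc.eventually hgC, hIco] with τ h1 h2
    rw [← hvγ τ h2, h1]
  -- Both sides are analytic at `T` and agree to the left of `T`, hence near `T` by the identity
  -- theorem. This is where analyticity of the arc forces it to remain on `C`.
  have hCh : ∀ᶠ τ in 𝓝 T, C (g (γ τ)) = γ τ := by
    have h1 : AnalyticAt ℝ (fun τ => C (g (γ τ))) T := (hC _).comp hh
    refine (h1.frequently_eq_iff_eventually_eq hγ).1 ?_
    have h2 : ∀ᶠ τ in 𝓝[<] T, C (g (γ τ)) = γ τ := by
      filter_upwards [hhv, hIco] with τ h3 h4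
      rw [h3, hvγ τ h4]
    exact h2.frequently.filter_mono (nhdsWithin_mono _ fun x hx => ne_of_lt hx)
  obtain ⟨a, haT, ha⟩ := (mem_nhdsLT_iff_exists_Ioo_subset' hsT).1 hhv
  obtain ⟨a', b, hT, hsub⟩ := mem_nhds_iff_exists_Ioo_subset.1
    (hCh.and hh.eventually_analyticAt)
  have hlift : ∀ τ, τ < T → (if τ < T then v τ else g (γ τ)) = v τ := fun τ h => if_pos h
  have hlift' : ∀ τ, max a a' < τ → (if τ < T then v τ else g (γ τ)) = g (γ τ) := by
    intro τ h
    split_ifs with h1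
    · exact (ha ⟨(le_max_left _ _).trans_lt h, h1⟩).symm
    · rfl
  refine ⟨min b r, lt_min hT.2 hTr, min_le_right _ _, fun τ => if τ < T then v τ else g (γ τ),
    ?_, hlift s hsT, ?_⟩
  · intro τ hτ
    rcases lt_or_ge τ T with h | h
    · have h1 : Set.Ico s T ∈ 𝓝[Set.Ico s (min b r)] τ := by
        filter_upwards [self_mem_nhdsWithin, nhdsWithin_le_nhds (Iio_mem_nhds h)] with x hx hx'
        exact ⟨hx.1, hx'⟩
      refine ((hv τ ⟨hτ.1, h⟩).mono_of_mem_nhdsWithin h1).congr_of_eventuallyEq ?_ (hlift τ h)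
      filter_upwards [nhdsWithin_le_nhds (Iio_mem_nhds h)] with x hx
      exact hlift x hx
    · have hτa : max a a' < τ := (max_lt haT hT.1).trans_le h
      have h1 : ContinuousAt (g ∘ γ) τ :=
        (hsub ⟨(le_max_right _ _).trans_lt hτa, hτ.2.trans_le (min_le_left _ _)⟩).2.continuousAt
      refine (h1.congr ?_).continuousWithinAt
      filter_upwards [Ioi_mem_nhds hτa] with x hx
      exact (hlift' x hx).symm
  · intro τ hτ
    rcases lt_or_ge τ T with h | h
    · beta_reduce
      rw [hlift τ h, hvγ τ ⟨hτ.1, h⟩]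
    · have hτa : max a a' < τ := (max_lt haT hT.1).trans_le h
      beta_reduce
      rw [hlift' τ hτa]
      exact (hsub ⟨(le_max_right _ _).trans_lt hτa, hτ.2.trans_le (min_le_left _ _)⟩).1

/-- The image of an analytic immersed curve `C` is analytically complete if continuous lifts of
convergent arcs converge. -/
theorem mem_range_of_analytic_of_mem_range {C : ℝ → E} (hC : ∀ v, AnalyticAt ℝ C v)
    (hinv : ∀ v₀, ∃ g : E → ℝ, AnalyticAt ℝ g (C v₀) ∧ ∀ᶠ v in 𝓝 v₀, g (C v) = v)
    (hlim : ∀ (v : ℝ → ℝ) (s t : ℝ) (p : E), s < t → ContinuousOn v (Set.Ico s t) →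
      Filter.Tendsto (fun τ => C (v τ)) (𝓝[<] t) (𝓝 p) → ∃ c, Filter.Tendsto v (𝓝[<] t) (𝓝 c))
    {γ : ℝ → E} (hγ : ContinuousOn γ (Set.Icc 0 1)) (hγ' : ∀ t ∈ Set.Ioo (0 : ℝ) 1, AnalyticAt ℝ γ t)
    {ε : ℝ} (hε : 0 < ε) (hε1 : ε < 1) (hmem : ∀ t ∈ Set.Ico 0 ε, γ t ∈ Set.range C) :
    ∀ t ∈ Set.Icc (0 : ℝ) 1, γ t ∈ Set.range C := by
  have hCc : Continuous C := continuous_iff_continuousAt.2 fun v => (hC v).continuousAt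
  obtain ⟨s, t₁, hs, hst, ht₁, v₁, hv₁, hv₁γ⟩ := exists_local_lift hCc hinv hε
    (hγ.mono fun t ht => ⟨ht.1.le, (ht.2.trans hε1).le⟩)
    fun t ht => hmem t ⟨ht.1.le, ht.2⟩
  -- The initial value of the lifts is fixed, so that lifts on different intervals agree where both
  -- are defined and glue to one on `[s, sSup Q)`.
  let Q : Set ℝ := {t | s < t ∧ t ≤ 1 ∧ ∃ v : ℝ → ℝ, ContinuousOn v (Set.Ico s t) ∧ v s = v₁ s ∧
    ∀ τ ∈ Set.Ico s t, C (v τ) = γ τ}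
  have ht₁Q : t₁ ∈ Q := ⟨hst, ht₁.trans hε1.le, v₁, hv₁, rfl, hv₁γ⟩
  have hQ : BddAbove Q := ⟨1, fun t ht => ht.2.1⟩
  set T := sSup Q with hTdef
  have hsT : s < T := hst.trans_le (le_csSup hQ ht₁Q)
  have hT1 : T ≤ 1 := csSup_le ⟨_, ht₁Q⟩ fun t ht => ht.2.1
  have hTQ : ∃ v : ℝ → ℝ, ContinuousOn v (Set.Ico s T) ∧ v s = v₁ s ∧
      ∀ τ ∈ Set.Ico s T, C (v τ) = γ τ := by
    have hex : ∀ t ∈ Q, ∃ v : ℝ → ℝ, ContinuousOn v (Set.Ico s t) ∧ v s = v₁ s ∧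
      ∀ τ ∈ Set.Ico s t, C (v τ) = γ τ := fun t ht => ht.2.2
    choose! u huc hus huγ using hex
    have hlt : ∀ τ, τ < T → ∃ t ∈ Q, τ < t := fun τ hτ => exists_lt_of_lt_csSup ⟨_, ht₁Q⟩ hτ
    choose! b hbQ hb using hlt
    have hinj := isLocallyInjective_of_local_leftInverse hinv
    have heq : ∀ t ∈ Q, ∀ τ, s ≤ τ → τ < t → τ < T → u (b τ) τ = u t τ := by
      intro t ht τ hsτ hτ hτT
      have hbτ := hbQ τ hτT
      exact lift_unique hinj (huc _ hbτ) (huc t ht) (huγ _ hbτ) (huγ t ht)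
        ((hus _ hbτ).trans (hus t ht).symm) hsτ (hb τ hτT) hτ
    refine ⟨fun τ => u (b τ) τ, ?_, hus _ (hbQ s hsT), fun τ hτ =>
      huγ _ (hbQ τ hτ.2) τ ⟨hτ.1, hb τ hτ.2⟩⟩
    intro τ hτ
    have hbτ := hbQ τ hτ.2
    have hτb := hb τ hτ.2
    have h1 : Set.Ico s (b τ) ∈ 𝓝[Set.Ico s T] τ := by
      filter_upwards [self_mem_nhdsWithin, nhdsWithin_le_nhds (Iio_mem_nhds hτb)] with x hx hx'
      exact ⟨hx.1, hx'⟩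
    refine ((huc _ hbτ τ ⟨hτ.1, hτb⟩).mono_of_mem_nhdsWithin h1).congr_of_eventuallyEq ?_ rfl
    filter_upwards [self_mem_nhdsWithin, h1] with x hx hx'
    exact heq _ hbτ x hx.1 hx'.2 hx.2
  obtain ⟨v, hv, hvs, hvγ⟩ := hTQ
  have hT0 : 0 < T := hs.trans hsT
  have hγT : Filter.Tendsto γ (𝓝[<] T) (𝓝 (γ T)) := by
    refine (hγ T ⟨hT0.le, hT1⟩).tendsto.mono_left ?_
    rw [← nhdsWithin_Ioo_eq_nhdsLT hT0]
    exact nhdsWithin_mono _ fun x hx => ⟨hx.1.le, hx.2.le.trans hT1⟩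
  have hCv : Filter.Tendsto (fun τ => C (v τ)) (𝓝[<] T) (𝓝 (γ T)) := by
    refine hγT.congr' ?_
    filter_upwards [Ico_mem_nhdsLT hsT] with τ hτ
    exact (hvγ τ hτ).symm
  obtain ⟨c, hc⟩ := hlim v s T (γ T) hsT hv hCv
  have hcT : C c = γ T := tendsto_nhds_unique ((hCc.tendsto c).comp hc) hCv
  -- The maximal lift converges at `T`; if `T < 1` it could be continued beyond `T`. At `T = 1` the
  -- limit alone suffices, so no analyticity at the endpoint is needed.
  have hT : T = 1 := by
    by_contra hne
    have hTlt : T < 1 := lt_of_le_of_ne hT1 hne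
    obtain ⟨b, hTb, hb1, w, hw, hws, hwγ⟩ := exists_lift_extension hC hinv hsT hTlt
      (hγ' T ⟨hT0, hTlt⟩) hv hvγ hc hcT
    have hbQ : b ∈ Q := ⟨hsT.trans hTb, hb1, w, hw, hws.trans hvs, hwγ⟩
    exact absurd (le_csSup hQ hbQ) (not_le.2 hTb)
  intro t ht
  rcases lt_or_ge t s with h | h
  -- Times before the start `s` of the lift lie in `[0, ε)`.
  · exact hmem t ⟨ht.1, h.trans (hst.trans_le ht₁)⟩
  · rcases lt_or_eq_of_le ht.2 with h1 | h1
    · exact ⟨v t, hvγ t ⟨h, by rwa [hT]⟩⟩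
    · exact ⟨c, by rw [hcT, hT, h1]⟩

end Lifting

theorem deSitter.contMDiff_coe :
    ContMDiff (𝓡 3) 𝓘(ℝ, EuclideanSpace ℝ (Fin 4)) ω
      (fun X : deSitter => (X : EuclideanSpace ℝ (Fin 4))) := by
  intro X
  obtain ⟨j, ε, hε, hX⟩ := deSitter.exists_chart X
  have hatlas : deSitter.chart j ε hε ∈ IsManifold.maximalAtlas (𝓡 3) ω deSitter :=
    IsManifold.subset_maximalAtlas ⟨j, ε, hε, rfl⟩
  have h1 := (deSitter.contDiffOn_fill j ε).contMDiffOn.comp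
    (contMDiffOn_of_mem_maximalAtlas hatlas) fun x hx => (deSitter.chart j ε hε).map_source hx
  refine (h1.contMDiffAt ((deSitter.chart j ε hε).open_source.mem_nhds hX)).congr_of_eventuallyEq ?_
  filter_upwards [(deSitter.chart j ε hε).open_source.mem_nhds hX] with Y hY
  exact (deSitter.fill_drop j hε Y.2 hY).symm

/-! ### Analytic completeness of the image -/

namespace LH

/-- The plane curve over which the image of the extension lies. -/
def planeCurve (v : ℝ) : ℝ × ℝ := (Real.sin (2 * v), y v)

theorem contDiff_planeCurve : ContDiff ℝ ω planeCurve := by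
  unfold planeCurve
  fun_prop

/-- Given `v`, the remaining coordinates must be `ξ = x₀ + x₃` and `x = x₁`, and the surface
equation is then the equation of de Sitter space. -/
theorem mem_range_extension_iff {X : deSitter} : X ∈ Set.range extension ↔
    ((X : EuclideanSpace ℝ (Fin 4)) 0 - (X : EuclideanSpace ℝ (Fin 4)) 3,
      (X : EuclideanSpace ℝ (Fin 4)) 2) ∈ Set.range planeCurve := by
  constructor
  · rintro ⟨p, rfl⟩
    refine ⟨(p : EuclideanSpace ℝ (Fin 3)) 2, ?_⟩
    rw [coe_extension]
    ext
    · simp [planeCurve, extensionVec]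
      ring
    · simp [planeCurve, extensionVec]
  · rintro ⟨v, hv⟩
    obtain ⟨h1, h2⟩ := Prod.ext_iff.1 hv
    simp only [planeCurve] at h1 h2
    have hX : lorentz (X : EuclideanSpace ℝ (Fin 4)) X = 1 := X.2
    have hmem : (!₂[(X : EuclideanSpace ℝ (Fin 4)) 0 + (X : EuclideanSpace ℝ (Fin 4)) 3,
        (X : EuclideanSpace ℝ (Fin 4)) 1, v] : EuclideanSpace ℝ (Fin 3)) ∈ surface := by
      change -_ * _ + _ + _ = (1 : ℝ)
      simp [h1, h2]
      rw [lorentz] at hX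
      linear_combination hX
    refine ⟨⟨_, hmem⟩, Subtype.ext ?_⟩
    rw [coe_extension]
    ext i
    fin_cases i <;> simp [extensionVec, h1, h2]

/-- The curve is regular, so pairing it with its velocity `(α, β)` at `v₀` gives a function with
derivative `α² + β² ≠ 0`, to which the inverse function theorem applies. -/
theorem exists_local_leftInverse_planeCurve (v₀ : ℝ) : ∃ g : ℝ × ℝ → ℝ,
    AnalyticAt ℝ g (planeCurve v₀) ∧ ∀ᶠ v in 𝓝 v₀, g (planeCurve v) = v := by
  set α := 2 * Real.cos (2 * v₀) with hα
  set β := 2 * v₀ * Real.cos (2 * v₀) - Real.sin (2 * v₀) with hβ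
  let ℓ : ℝ × ℝ → ℝ := fun x => α * x.1 + β * x.2
  have hf : ContDiff ℝ ω (fun v => ℓ (planeCurve v)) :=
    (show ContDiff ℝ ω ℓ by fun_prop).comp contDiff_planeCurve
  have hd : HasDerivAt (fun v => ℓ (planeCurve v)) (α ^ 2 + β ^ 2) v₀ := by
    have h1 := (((hasDerivAt_id v₀).const_mul 2).sin.const_mul α).add
      ((hasDerivAt_y v₀).const_mul β)
    refine h1.congr_deriv ?_
    simp [hα, hβ]
    ring
  have hne : α ^ 2 + β ^ 2 ≠ 0 := by
    intro h
    have hα0 : α = 0 := by nlinarith [sq_nonneg α, sq_nonneg β]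
    have hβ0 : β = 0 := by nlinarith [sq_nonneg α, sq_nonneg β]
    have hc : Real.cos (2 * v₀) = 0 := by linarith
    rw [hβ, hc] at hβ0
    have h3 := Real.sin_sq_add_cos_sq (2 * v₀)
    rw [hc, show Real.sin (2 * v₀) = 0 by linarith] at h3
    norm_num at h3
  obtain ⟨e, he, hef, hes⟩ := hf.exists_openPartialHomeomorph (p := v₀) (by
    intro d hd0
    rw [hd.hasFDerivAt.fderiv] at hd0
    simpa [hne] using hd0)
  refine ⟨fun x => e.symm (ℓ x), ?_, ?_⟩
  · have h1 : ℓ (planeCurve v₀) ∈ e.target := by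
      rw [← hef]
      exact e.map_source he
    have h2 : AnalyticAt ℝ e.symm (ℓ (planeCurve v₀)) :=
      (hes.contDiffAt (e.open_target.mem_nhds h1)).analyticAt
    exact h2.comp (show ContDiff ℝ ω ℓ by fun_prop).contDiffAt.analyticAt
  · filter_upwards [e.open_source.mem_nhds he] with v hv
    rw [← hef, e.left_inv hv]

theorem analyticallyComplete_range_extension :
    AnalyticallyComplete 3 (Set.range extension) := by
  refine ⟨⟨_, ⟨0, zero_mem_surface⟩, rfl⟩, ?_⟩
  rintro Γ hΓ ⟨ε, hε, hε1, hmem⟩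
  let π : EuclideanSpace ℝ (Fin 4) → ℝ × ℝ := fun x => (x 0 - x 3, x 2)
  have hπ : ContDiff ℝ ω π := by fun_prop
  have hγ : ContMDiffOn 𝓘(ℝ, ℝ) 𝓘(ℝ, ℝ × ℝ) ω
      (fun t => π (Γ t : EuclideanSpace ℝ (Fin 4))) (Set.Icc 0 1) :=
    (hπ.contMDiff.comp deSitter.contMDiff_coe).comp_contMDiffOn hΓ
  have key := mem_range_of_analytic_of_mem_range
    (fun v => contDiff_planeCurve.contDiffAt.analyticAt) exists_local_leftInverse_planeCurve
    (fun v s t p hst hv hp => exists_tendsto_of_tendsto_sin_two_mul hst hv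
      ((continuous_fst.tendsto p).comp hp)) hγ.continuousOn
    (fun t ht => ((contMDiffOn_iff_contDiffOn.1 hγ).contDiffAt
      (Icc_mem_nhds ht.1 ht.2)).analyticAt) hε hε1
    fun t ht => mem_range_extension_iff.1 (hmem t ht)
  exact fun t ht => mem_range_extension_iff.2 (key t ht)

end LH

end

theorem mainTheorem11 :
    ∃ D : DCStructure 2 LH.surface,
      -- the DC-structure is the one induced from the ambient space
      D.IsDCImmersion 3 (fun p : LH.surface => (p : EuclideanSpace ℝ (Fin 3))) ∧
      {p | D.IsDCPoint p}.Countable ∧ {p | D.IsDCPoint p}.Infinite ∧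
      D.IsSpacelikeCMCOneDCImmersion LH.extension ∧
      D.IsSpacelikeCMCOneOn LH.extension (LH.extension ⁻¹' (LH.line 1 ∪ LH.line (-1)))ᶜ ∧
      DCStructure.IsAnalyticExtension 3 planeDC D LH.catenoid LH.extension ∧
      Set.range LH.extension = Set.range LH.catenoid ∪ LH.line 1 ∪ LH.line (-1) ∧
      ¬ IsProperMap LH.extension ∧
      IsArcProper 3 0 LH.extension ∧
      AnalyticallyComplete 3 (Set.range LH.extension) :=
  ⟨LH.surfaceDC, LH.isDCImmersion_inclusion, LH.countable_isDCPoint, LH.infinite_isDCPoint,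
    LH.isSpacelikeCMCOneDCImmersion_extension, LH.isSpacelikeCMCOneOn_extension,
    LH.isAnalyticExtension, LH.range_extension, LH.not_isProperMap_extension,
    LH.isArcProper_extension, LH.analyticallyComplete_range_extension⟩
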